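/- Let $a\in\mathbb R$, $\sigma>0$, and let $(X_t)_{t\ge 1}$ be a (strictly) stationary Gaussian AR(1) process: $X_{t+1}=aX_t+\varepsilon_{t+1}$ for $t\ge 1$, where $\varepsilon_2,\varepsilon_3,\dots$ are i.i.d. $N(0,\sigma^2)$ and independent of $X_1$. For $\alpha\in\mathbb R$, $v>0$ put $$g_{\alpha,v}(w,x,y,z)=\frac1{2\pi v}\exp\Big(-\frac{(x-\alpha w)^2+(y-\alpha x)^2+(z-\alpha y)^2}{2v}\Big),\qquad s_{\alpha,v}(w;x_1,x_2,x_3)=\frac{6\,g_{\alpha,v}(w,x_1,x_2,x_3)}{\sum_{\tau\in\mathfrak S_3}g_{\alpha,v}(w,x_{\tau(1)},x_{\tau(2)},x_{\tau(3)})}.$$ For $t\ge 2$ let $S^*_t=s_{a,\sigma^2}(X_{3t};X_{3t+1},X_{3t+2},X_{3t+3})$ be the oracle's betting score and $\hat S^*_t=s_{\hat a_t,\hat\sigma_t^2}(X_{3t};X_{3t+1},X_{3t+2},X_{3t+3})$ the plug-in score, where $$\hat a_t=\frac{\sum_{i=2}^{3t}X_iX_{i-1}}{\sum_{i=1}^{3t-1}X_i^2}\quad(t\ge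 1),\qquad \hat\sigma_t^2=\frac1{3t-1}\sum_{i=2}^{3t}\big(X_i-\hat a_{t-1}X_{i-1}\big)^2\quad(t\ge 2).$$ Put $\hat S^*_1=1$ and let $W^*_n=\prod_{t=1}^n\hat S^*_t$ be the bettor's wealth after $n$ rounds of betting on triples. Then $\log S^*_2$ is integrable and, as $n\to\infty$, $$\frac{\log W^*_n}{3n}\longrightarrow \tilde r^*:=\tfrac13\,\mathbb E\big[\log S^*_2\big]\quad\text{almost surely}.$$ Moreover $\tilde r^*\ge 0$, with equality if and only if $a=0$; and if $a=0$ the sequence $(X_t)_{t\ge1}$ is exchangeable, i.e. the null hypothesis of exchangeability holds. -/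

import Mathlib

open MeasureTheory ProbabilityTheory Filter Topology

noncomputable section

namespace TripleBetting

/-- The process `X 1, X 2, …` (the value `X 0` plays no role) is a strictly stationary Gaussian
AR(1) process with coefficient `a` and innovation variance `σ ^ 2`:
`X (t + 1) = a * X t + ε (t + 1)` for `t ≥ 1`, where `ε 2, ε 3, …` are i.i.d. `N(0, σ ^ 2)` and
independent of the initial value `X 1`. -/
structure IsStationaryGaussianAR1 {Ω : Type*} [MeasurableSpace Ω]
    (a σ : ℝ) (X ε : ℕ → Ω → ℝ) (μ : Measure Ω) : Prop where
  measurable_X : ∀ t, 1 ≤ t → Measurable (X t)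
  measurable_innovation : ∀ t, 2 ≤ t → Measurable (ε t)
  recursion : ∀ t, 1 ≤ t → ∀ᵐ ω ∂μ, X (t + 1) ω = a * X t ω + ε (t + 1) ω
  innovation_law : ∀ t, 2 ≤ t → μ.map (ε t) = gaussianReal 0 (Real.toNNReal (σ ^ 2))
  /-- `X 1, ε 2, ε 3, …` are mutually independent. -/
  indep : iIndepFun (fun n : ℕ => if n = 0 then X 1 else ε (n + 1)) μ
  /-- The law of the process on path space is invariant under time shifts. -/
  stationary : ∀ k : ℕ,
    μ.map (fun ω (t : ℕ) => X (t + 1 + k) ω) = μ.map (fun ω (t : ℕ) => X (t + 1) ω)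

/-- `X 1, X 2, …` is exchangeable: for every `n`, the law of `(X 1, …, X n)` is invariant under
all permutations of the indices. -/
def IsExchangeable {Ω : Type*} [MeasurableSpace Ω] (X : ℕ → Ω → ℝ) (μ : Measure Ω) : Prop :=
  ∀ (n : ℕ) (τ : Equiv.Perm (Fin n)),
    μ.map (fun ω (i : Fin n) => X ((τ i : ℕ) + 1) ω) =
      μ.map (fun ω (i : Fin n) => X ((i : ℕ) + 1) ω)

/-- Likelihood of the successive values `x, y, z` given the preceding value `w` under the AR(1)
model with coefficient `a` and innovation variance `v`. Only ratios of `g` at equal `a, v` are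
ever used, so the constant factor is immaterial. -/
def g (a v w x y z : ℝ) : ℝ :=
  1 / (2 * Real.pi * v) *
    Real.exp (-(1 / (2 * v)) * (x - a * w) ^ 2 - 1 / (2 * v) * (y - a * x) ^ 2
      - 1 / (2 * v) * (z - a * y) ^ 2)

/-- Betting score for the ordered triple `x`, given the preceding value `w` and the unordered
triple: likelihood ratio of the AR(1) model with parameters `a, v` to the uniform distribution on
the `3!` orderings. -/
def score (a v w : ℝ) (x : Fin 3 → ℝ) : ℝ :=
  6 * g a v w (x 0) (x 1) (x 2) /
    ∑ τ : Equiv.Perm (Fin 3), g a v w (x (τ 0)) (x (τ 1)) (x (τ 2))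

variable {Ω : Type*}

/-- The triple `(X (3t+1), X (3t+2), X (3t+3))`. -/
def triple (X : ℕ → Ω → ℝ) (t : ℕ) (ω : Ω) : Fin 3 → ℝ :=
  ![X (3 * t + 1) ω, X (3 * t + 2) ω, X (3 * t + 3) ω]

/-- The oracle's betting score in round `t`, with the true parameters (no bet if `t ≤ 1`). -/
def oracleScore (a σ : ℝ) (X : ℕ → Ω → ℝ) (t : ℕ) (ω : Ω) : ℝ :=
  if t ≤ 1 then 1 else score a (σ ^ 2) (X (3 * t) ω) (triple X t ω)

/-- Least squares estimator of the coefficient from `X 1, …, X (3t)`. -/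
def aHat (X : ℕ → Ω → ℝ) (t : ℕ) (ω : Ω) : ℝ :=
  (∑ i ∈ Finset.Icc 2 (3 * t), X i ω * X (i - 1) ω) /
    ∑ i ∈ Finset.Icc 1 (3 * t - 1), X i ω ^ 2

/-- Estimator of the innovation variance from `X 1, …, X (3t)`, used for `t ≥ 2`; the residuals
are formed with the coefficient estimate of the preceding round. -/
def sigmaSqHat (X : ℕ → Ω → ℝ) (t : ℕ) (ω : Ω) : ℝ :=
  1 / (3 * (t : ℝ) - 1) *
    ∑ i ∈ Finset.Icc 2 (3 * t), (X i ω - aHat X (t - 1) ω * X (i - 1) ω) ^ 2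

/-- The plug-in betting score in round `t` (no bet if `t ≤ 1`). -/
def plugInScore (X : ℕ → Ω → ℝ) (t : ℕ) (ω : Ω) : ℝ :=
  if t ≤ 1 then 1 else score (aHat X t ω) (sigmaSqHat X t ω) (X (3 * t) ω) (triple X t ω)

/-- The bettor's wealth after `n` rounds. -/
def wealth (X : ℕ → Ω → ℝ) (n : ℕ) (ω : Ω) : ℝ :=
  ∏ t ∈ Finset.Icc 1 n, plugInScore X t ω

/-- One third of the expected logarithm of the oracle's score in the first round with a bet. -/
def growthRate [MeasurableSpace Ω] (a σ : ℝ) (X : ℕ → Ω → ℝ) (μ : Measure Ω) : ℝ :=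
  1 / 3 * ∫ ω, Real.log (oracleScore a σ X 2 ω) ∂μ

end TripleBetting

end

noncomputable section

namespace TripleBetting

/-! In the score, every factor of the likelihood that does not depend on the order of the triple
cancels. What remains is the exponential of `logScore p q`, a function of the block `(X (3t), …, X
(3t+3))` with `p = a / v` and `q = a ^ 2 / (2 v)`. It is a quadratic form minus a log-sum-exp of
quadratic forms. Log-sum-exp is 1-Lipschitz for the sup norm, so `logScore` is locally Lipschitz in
the block with linearly growing constant (`QuadLip`), and its dependence on `(p, q)` is controlled
by `‖u‖ ^ 2`. Second moments therefore suffice throughout.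

Stationarity forces `|a| < 1` and a centred Gaussian marginal, as iterating the characteristic
function identity shows. Hence `X (n + k)` differs from a function of `k` innovations by `a ^ k * X
n`. Blocks truncated in this way are i.i.d. along residue classes. The strong law for i.i.d.
variables, combined with approximation, gives a strong law for every `QuadLip` function of the
blocks (`tendsto_average_block`). Applied to quadratic functions it yields consistency of the
estimators. Applied to `logScore` it yields the growth of the oracle's log wealth. The plug-in error
is at most `δ_t ‖block‖ ^ 2` with `δ_t → 0`, so it vanishes on average.

For the sign, let `S` be the oracle's score. Multiplying the transition density of a triple by `1 /
S` gives the mean of the densities of its six reorderings, so `E[1 / S] = 1`. Hence `E[log S] =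
E[log S + 1 / S - 1]`, where the integrand is nonnegative and vanishes only at `S = 1`. If `a ≠ 0`,
then `S > 1` at the block `(0, 0, 0, 1)`, hence `S ≠ 1` on a nonempty open set of positive
probability. If `a = 0`, the process is i.i.d. and the score is identically `1`. -/

/-! ### Cesàro averages of deterministic sequences -/

lemma tendsto_average_shift {u : ℕ → ℝ} {c : ℝ} (k : ℕ)
    (h : Tendsto (fun n : ℕ => (∑ j ∈ Finset.range n, u (j + k)) / n) atTop (𝓝 c)) :
    Tendsto (fun n : ℕ => (∑ j ∈ Finset.range n, u j) / n) atTop (𝓝 c) := by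
  rw [← tendsto_add_atTop_iff_nat k]
  have hk : Tendsto (fun n : ℕ => (n : ℝ) / ((n : ℝ) + k)) atTop (𝓝 1) :=
    tendsto_natCast_div_add_atTop (k : ℝ)
  have h0 : Tendsto (fun n : ℕ => (∑ j ∈ Finset.range k, u j) / ((n + k : ℕ) : ℝ)) atTop (𝓝 0) :=
    (tendsto_const_div_atTop_nhds_zero_nat _).comp (tendsto_add_atTop_nat k)
  have := (h.mul hk).add h0
  rw [mul_one, add_zero] at this
  refine this.congr' ?_
  filter_upwards [eventually_gt_atTop 0] with n hn
  have hn' : (n : ℝ) ≠ 0 := by positivity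
  have : (n : ℝ) + k ≠ 0 := by positivity
  rw [add_comm n k, Finset.sum_range_add]
  simp_rw [add_comm k]
  push_cast
  field_simp
  ring

lemma sum_range_eq_sum_residues (u : ℕ → ℝ) {L : ℕ} (hL : 0 < L) (n : ℕ) :
    ∑ j ∈ Finset.range n, u j =
      ∑ r ∈ Finset.range L, ∑ j ∈ Finset.range (Nat.count (· ≡ r [MOD L]) n), u (r + L * j) := by
  induction n with
  | zero => simp
  | succ n ih =>
    have key : ∀ r ∈ Finset.range L,
        ∑ j ∈ Finset.range (Nat.count (· ≡ r [MOD L]) (n + 1)), u (r + L * j) =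
        ∑ j ∈ Finset.range (Nat.count (· ≡ r [MOD L]) n), u (r + L * j) +
          if n % L = r then u n else 0 := by
      intro r hr
      have hr' := Finset.mem_range.1 hr
      rw [Nat.count_succ]
      have hiff : n ≡ r [MOD L] ↔ n % L = r := by
        rw [Nat.ModEq, Nat.mod_eq_of_lt hr']
      by_cases h : n % L = r
      · rw [if_pos (hiff.2 h), if_pos h, Finset.sum_range_succ]
        -- When `n % L = r`, exactly `n / L` members of the class of `r` lie below `n`, so the new
        -- term has index `r + L * (n / L) = n`.
        congr 2
        rw [Nat.count_modEq_card _ hL, Nat.mod_eq_of_lt hr', h, if_neg (lt_irrefl _), add_zero,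
          ← h, Nat.mod_add_div]
      · rw [if_neg (fun h' => h (hiff.1 h')), if_neg h, add_zero, add_zero]
    rw [Finset.sum_congr rfl key, Finset.sum_add_distrib, ← ih, Finset.sum_range_succ,
      Finset.sum_ite_eq, if_pos (Finset.mem_range.2 (Nat.mod_lt _ hL))]

lemma tendsto_count_modEq_div {L : ℕ} (hL : 0 < L) (r : ℕ) :
    Tendsto (fun n : ℕ => (Nat.count (· ≡ r [MOD L]) n : ℝ) / n) atTop (𝓝 (1 / L)) := by
  have hL' : (0 : ℝ) < L := by exact_mod_cast hL
  have h1 : Tendsto (fun n : ℕ => (1 : ℝ) / L - 1 / n) atTop (𝓝 (1 / L)) := by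
    simpa using (tendsto_const_nhds (x := (1 : ℝ) / L)).sub
      (tendsto_const_div_atTop_nhds_zero_nat (1 : ℝ))
  have h2 : Tendsto (fun n : ℕ => (1 : ℝ) / L + 1 / n) atTop (𝓝 (1 / L)) := by
    simpa using (tendsto_const_nhds (x := (1 : ℝ) / L)).add
      (tendsto_const_div_atTop_nhds_zero_nat (1 : ℝ))
  have hb : ∀ n : ℕ, (n : ℝ) / L - 1 ≤ Nat.count (· ≡ r [MOD L]) n ∧
      (Nat.count (· ≡ r [MOD L]) n : ℝ) ≤ (n : ℝ) / L + 1 := by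
    intro n
    rw [Nat.count_modEq_card _ hL]
    have hd : (n : ℝ) = (n % L : ℕ) + L * (n / L : ℕ) := by exact_mod_cast (Nat.mod_add_div n L).symm
    have hm : ((n % L : ℕ) : ℝ) < L := by exact_mod_cast Nat.mod_lt n hL
    have hm0 : (0 : ℝ) ≤ ((n % L : ℕ) : ℝ) := by positivity
    have hq : (n : ℝ) / L = ((n % L : ℕ) : ℝ) / L + (n / L : ℕ) := by
      field_simp
      linarith
    have h3 : ((n % L : ℕ) : ℝ) / L < 1 := by rw [div_lt_one hL']; exact hm
    have h4 : 0 ≤ ((n % L : ℕ) : ℝ) / L := by positivity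
    rw [hq]
    push_cast
    split_ifs <;> constructor <;> linarith
  refine tendsto_of_tendsto_of_tendsto_of_le_of_le' h1 h2 ?_ ?_
  · filter_upwards [eventually_gt_atTop 0] with n hn
    have hn' : (0 : ℝ) < n := by exact_mod_cast hn
    rw [le_div_iff₀ hn']
    calc _ = (n : ℝ) / L - 1 := by field_simp
      _ ≤ _ := (hb n).1
  · filter_upwards [eventually_gt_atTop 0] with n hn
    have hn' : (0 : ℝ) < n := by exact_mod_cast hn
    rw [div_le_iff₀ hn']
    calc _ ≤ (n : ℝ) / L + 1 := (hb n).2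
      _ = _ := by field_simp

/-- The average is the sum over classes of the class averages, each weighted by its proportion of
indices, which tends to `1 / L`. -/
lemma tendsto_average_of_residues {u : ℕ → ℝ} {c : ℝ} {L : ℕ} (hL : 0 < L)
    (h : ∀ r < L, Tendsto (fun n : ℕ => (∑ j ∈ Finset.range n, u (r + L * j)) / n) atTop (𝓝 c)) :
    Tendsto (fun n : ℕ => (∑ j ∈ Finset.range n, u j) / n) atTop (𝓝 c) := by
  have hL' : (0 : ℝ) < L := by exact_mod_cast hL
  have hcount : ∀ r, Tendsto (fun n : ℕ => Nat.count (· ≡ r [MOD L]) n) atTop atTop := by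
    intro r
    have h1 : Tendsto (fun n : ℕ => (Nat.count (· ≡ r [MOD L]) n : ℝ)) atTop atTop := by
      have := (tendsto_count_modEq_div hL r).pos_mul_atTop (by positivity)
        (tendsto_natCast_atTop_atTop (R := ℝ))
      refine this.congr' ?_
      filter_upwards [eventually_gt_atTop 0] with n hn
      have hn' : (n : ℝ) ≠ 0 := by positivity
      field_simp
    exact tendsto_natCast_atTop_iff.1 h1
  have hsum : Tendsto (fun n : ℕ => ∑ r ∈ Finset.range L,
      (∑ j ∈ Finset.range (Nat.count (· ≡ r [MOD L]) n), u (r + L * j)) / n) atTop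
      (𝓝 (∑ r ∈ Finset.range L, c * (1 / L))) := by
    refine tendsto_finsetSum _ fun r hr => ?_
    have := ((h r (Finset.mem_range.1 hr)).comp (hcount r)).mul (tendsto_count_modEq_div hL r)
    refine this.congr' ?_
    filter_upwards [(hcount r).eventually_gt_atTop 0] with n hn
    have hn' : ((Nat.count (· ≡ r [MOD L]) n : ℕ) : ℝ) ≠ 0 := by positivity
    simp only [Function.comp]
    field_simp
  have hc : ∑ r ∈ Finset.range L, c * (1 / (L : ℝ)) = c := by
    rw [Finset.sum_const, Finset.card_range, nsmul_eq_mul]; field_simp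
  rw [hc] at hsum
  refine hsum.congr fun n => ?_
  rw [sum_range_eq_sum_residues u hL n, Finset.sum_div]

/-- The comparison sequence may have a limit `c'` other than `c`. This suits truncation, where the
limit changes with the truncation level. -/
lemma tendsto_average_of_approx {u : ℕ → ℝ} {c : ℝ}
    (h : ∀ η > 0, ∃ (v : ℕ → ℝ) (c' : ℝ),
      Tendsto (fun n : ℕ => (∑ j ∈ Finset.range n, v j) / n) atTop (𝓝 c') ∧ |c' - c| ≤ η ∧
      ∀ᶠ n : ℕ in atTop, |∑ j ∈ Finset.range n, u j - ∑ j ∈ Finset.range n, v j| ≤ η * n) :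
    Tendsto (fun n : ℕ => (∑ j ∈ Finset.range n, u j) / n) atTop (𝓝 c) := by
  rw [Metric.tendsto_atTop']
  intro e he
  obtain ⟨v, c', hv, hc, huv⟩ := h (e / 4) (by positivity)
  have hv' := (Metric.tendsto_nhds.1 hv) (e / 4) (by positivity)
  obtain ⟨N, hN⟩ := eventually_atTop.1 (hv'.and (huv.and (eventually_gt_atTop 0)))
  refine ⟨N, fun n hn => ?_⟩
  obtain ⟨h1, h2, h3⟩ := hN n hn.le
  have hn' : (0 : ℝ) < n := by exact_mod_cast h3
  rw [Real.dist_eq] at h1 ⊢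
  have h4 : |(∑ j ∈ Finset.range n, u j) / n - (∑ j ∈ Finset.range n, v j) / n| ≤ e / 4 := by
    rw [← sub_div, abs_div, abs_of_pos hn', div_le_iff₀ hn']; exact h2
  rw [abs_le] at h4 hc
  rw [abs_lt] at h1 ⊢
  constructor <;> linarith [h4.1, h4.2, hc.1, hc.2, h1.1, h1.2]

/-- The sequence `d` is little-o of `q + 1`, and this passes to partial sums because those of `q +
1` diverge. The added `1` ensures divergence even if `∑ q` stays bounded. -/
lemma tendsto_average_zero_of_abs_le_mul {d q δ : ℕ → ℝ} {B : ℝ} (hδ : Tendsto δ atTop (𝓝 0))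
    (hq : ∀ n, 0 ≤ q n) (hd : ∀ᶠ n in atTop, |d n| ≤ δ n * q n)
    (hB : ∀ᶠ n : ℕ in atTop, ∑ j ∈ Finset.range n, q j ≤ B * n) :
    Tendsto (fun n : ℕ => (∑ j ∈ Finset.range n, d j) / n) atTop (𝓝 0) := by
  have h1 : d =o[atTop] (fun n => q n + 1) := by
    rw [Asymptotics.isLittleO_iff]
    intro e he
    filter_upwards [hδ.eventually_lt_const he, hd] with n hn hdn
    rw [Real.norm_eq_abs, Real.norm_eq_abs, abs_of_nonneg (add_nonneg (hq n) zero_le_one)]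
    have h0 := hq n
    exact hdn.trans (by nlinarith)
  have hsum : ∀ n : ℕ, ∑ j ∈ Finset.range n, (q j + 1) = ∑ j ∈ Finset.range n, q j + n := by
    intro n; simp [Finset.sum_add_distrib]
  have h2 := h1.sum_range (fun n => add_nonneg (hq n) zero_le_one) (by
    refine tendsto_atTop_mono (fun n => ?_) (tendsto_natCast_atTop_atTop (R := ℝ))
    rw [hsum]
    linarith [Finset.sum_nonneg (s := Finset.range n) (fun j _ => hq j)])
  have h3 : (fun n : ℕ => ∑ j ∈ Finset.range n, (q j + 1)) =O[atTop] (fun n : ℕ => (n : ℝ)) := by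
    refine Asymptotics.IsBigO.of_bound (|B| + 1) ?_
    filter_upwards [hB] with n hn
    rw [hsum, Real.norm_eq_abs, Real.norm_eq_abs, Nat.abs_cast, abs_of_nonneg (by
      have := Finset.sum_nonneg (s := Finset.range n) (fun j _ => hq j)
      positivity)]
    nlinarith [le_abs_self B, (Nat.cast_nonneg n : (0 : ℝ) ≤ n)]
  exact (h2.trans_isBigO h3).tendsto_div_nhds_zero

/-! ### Functions with quadratic growth and linearly growing Lipschitz constant -/

/-- `f` is Lipschitz on balls, with a constant growing linearly in the radius. -/
def QuadLip (C : ℝ) (f : (Fin 4 → ℝ) → ℝ) : Prop :=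
  ∀ u v, |f u - f v| ≤ C * (‖u - v‖ * (‖u‖ + ‖v‖))

lemma QuadLip.continuous {C : ℝ} {f : (Fin 4 → ℝ) → ℝ} (hf : QuadLip C f) : Continuous f := by
  rw [continuous_iff_continuousAt]
  intro u
  rw [ContinuousAt, tendsto_iff_dist_tendsto_zero]
  have h : Tendsto (fun v : Fin 4 → ℝ => C * (‖v - u‖ * (‖v‖ + ‖u‖))) (𝓝 u) (𝓝 0) := by
    have : Continuous fun v : Fin 4 → ℝ => C * (‖v - u‖ * (‖v‖ + ‖u‖)) := by fun_prop
    simpa using this.tendsto u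
  exact squeeze_zero (fun _ => dist_nonneg) (fun v => by rw [Real.dist_eq]; exact hf v u) h

lemma QuadLip.abs_le {C : ℝ} {f : (Fin 4 → ℝ) → ℝ} (hf : QuadLip C f) (u : Fin 4 → ℝ) :
    |f u - f 0| ≤ C * ‖u‖ ^ 2 := by
  have := hf u 0
  simpa [sq] using this

lemma quadLip_mul (i j : Fin 4) : QuadLip 1 (fun u => u i * u j) := by
  intro u v
  have hi : |u i - v i| ≤ ‖u - v‖ := norm_le_pi_norm (u - v) i
  have hj : |u j - v j| ≤ ‖u - v‖ := norm_le_pi_norm (u - v) j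
  have hu : |u i| ≤ ‖u‖ := norm_le_pi_norm u i
  have hv : |v j| ≤ ‖v‖ := norm_le_pi_norm v j
  calc |u i * u j - v i * v j| = |u i * (u j - v j) + (u i - v i) * v j| := by ring_nf
    _ ≤ |u i| * |u j - v j| + |u i - v i| * |v j| := by
      rw [← abs_mul, ← abs_mul]; exact abs_add_le _ _
    _ ≤ ‖u‖ * ‖u - v‖ + ‖u - v‖ * ‖v‖ := by gcongr
    _ = _ := by ring

lemma QuadLip.add {C D : ℝ} {f g : (Fin 4 → ℝ) → ℝ} (hf : QuadLip C f) (hg : QuadLip D g) :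
    QuadLip (C + D) (fun u => f u + g u) := by
  intro u v
  calc |f u + g u - (f v + g v)| = |(f u - f v) + (g u - g v)| := by ring_nf
    _ ≤ |f u - f v| + |g u - g v| := abs_add_le _ _
    _ ≤ _ := by linarith [hf u v, hg u v]

lemma QuadLip.const_mul {C : ℝ} {f : (Fin 4 → ℝ) → ℝ} (hf : QuadLip C f) (b : ℝ) :
    QuadLip (|b| * C) (fun u => b * f u) := by
  intro u v
  rw [← mul_sub, abs_mul, mul_assoc]
  exact mul_le_mul_of_nonneg_left (hf u v) (abs_nonneg b)

/-! ### The log score as a function of a block -/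

/-- Lag-one cross products of a block of four successive values. -/
def crossSum (u : Fin 4 → ℝ) : ℝ := u 0 * u 1 + u 1 * u 2 + u 2 * u 3

/-- The order-dependent part of the log-likelihood of the last three entries given the first. -/
def logLik (p q : ℝ) (u : Fin 4 → ℝ) : ℝ := p * crossSum u + -q * (u 1 * u 1 + u 2 * u 2)

/-- Permutation of the last three entries. -/
def permTail (τ : Equiv.Perm (Fin 3)) (u : Fin 4 → ℝ) : Fin 4 → ℝ :=
  Fin.cons (u 0) (fun i => u (τ i).succ)

/-- The logarithm of the score as a function of the block, with `p = a / v`, `q = a ^ 2 / (2 v)`. -/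
def logScore (p q : ℝ) (u : Fin 4 → ℝ) : ℝ :=
  Real.log 6 + logLik p q u -
    Real.log (∑ τ : Equiv.Perm (Fin 3), Real.exp (logLik p q (permTail τ u)))

lemma quadLip_crossSum : QuadLip 3 crossSum := by
  have := ((quadLip_mul 0 1).add (quadLip_mul 1 2)).add (quadLip_mul 2 3)
  norm_num at this
  exact this

lemma quadLip_logLik (p q : ℝ) : QuadLip (|p| * 3 + |-q| * (1 + 1)) (logLik p q) :=
  (quadLip_crossSum.const_mul p).add (((quadLip_mul 1 1).add (quadLip_mul 2 2)).const_mul (-q))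

lemma norm_permTail_sub_le (τ : Equiv.Perm (Fin 3)) (u v : Fin 4 → ℝ) :
    ‖permTail τ u - permTail τ v‖ ≤ ‖u - v‖ := by
  refine (pi_norm_le_iff_of_nonneg (norm_nonneg _)).2 fun i => ?_
  refine Fin.cases ?_ (fun j => ?_) i
  · simpa [permTail] using norm_le_pi_norm (u - v) 0
  · simpa [permTail] using norm_le_pi_norm (u - v) (τ j).succ

lemma norm_permTail_le (τ : Equiv.Perm (Fin 3)) (u : Fin 4 → ℝ) : ‖permTail τ u‖ ≤ ‖u‖ := by
  refine (pi_norm_le_iff_of_nonneg (norm_nonneg _)).2 fun i => ?_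
  refine Fin.cases ?_ (fun j => ?_) i
  · simpa [permTail] using norm_le_pi_norm u 0
  · simpa [permTail] using norm_le_pi_norm u (τ j).succ

/-- Log-sum-exp is monotone and commutes with adding a constant to all arguments. -/
lemma abs_log_sum_exp_sub_le {ι : Type*} [Fintype ι] [Nonempty ι] {f g : ι → ℝ} {η : ℝ}
    (h : ∀ i, |f i - g i| ≤ η) :
    |Real.log (∑ i, Real.exp (f i)) - Real.log (∑ i, Real.exp (g i))| ≤ η := by
  have pos : ∀ f : ι → ℝ, 0 < ∑ i, Real.exp (f i) := fun f =>
    Finset.sum_pos (fun i _ => Real.exp_pos _) Finset.univ_nonempty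
  have one : ∀ f g : ι → ℝ, (∀ i, f i - g i ≤ η) →
      Real.log (∑ i, Real.exp (f i)) - Real.log (∑ i, Real.exp (g i)) ≤ η := by
    intro f g h
    rw [sub_le_iff_le_add, ← Real.log_exp η, ← Real.log_mul (Real.exp_ne_zero _) (pos g).ne',
      Finset.mul_sum]
    refine Real.log_le_log (pos f) (Finset.sum_le_sum fun i _ => ?_)
    rw [← Real.exp_add, Real.exp_le_exp]
    linarith [h i]
  rw [abs_le]
  constructor
  · have := one g f (fun i => by have := (abs_le.1 (h i)).1; linarith)
    linarith
  · exact one f g (fun i => (abs_le.1 (h i)).2)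

/-- One `η` comes from the numerator of the score and one from the logarithm of its denominator. -/
lemma abs_logScore_sub_le {p q p' q' η : ℝ} {u u' : Fin 4 → ℝ}
    (h₀ : |logLik p q u - logLik p' q' u'| ≤ η)
    (h : ∀ τ, |logLik p q (permTail τ u) - logLik p' q' (permTail τ u')| ≤ η) :
    |logScore p q u - logScore p' q' u'| ≤ 2 * η := by
  have h1 := abs_le.1 (abs_log_sum_exp_sub_le h)
  have h2 := abs_le.1 h₀
  rw [logScore, logScore, abs_le]
  constructor <;> linarith [h1.1, h1.2, h2.1, h2.2]

lemma quadLip_logScore (p q : ℝ) :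
    QuadLip (2 * (|p| * 3 + |-q| * (1 + 1))) (logScore p q) := by
  intro u v
  rw [mul_assoc]
  refine abs_logScore_sub_le (quadLip_logLik p q u v) fun τ => ?_
  refine (quadLip_logLik p q _ _).trans ?_
  gcongr
  · exact norm_permTail_sub_le τ u v
  · exact norm_permTail_le τ u
  · exact norm_permTail_le τ v

lemma abs_logLik_sub_param_le (p q p' q' : ℝ) (u : Fin 4 → ℝ) :
    |logLik p q u - logLik p' q' u| ≤ (3 * |p - p'| + 2 * |q - q'|) * ‖u‖ ^ 2 := by
  have h1 : |crossSum u| ≤ 3 * ‖u‖ ^ 2 := by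
    simpa [crossSum] using quadLip_crossSum.abs_le u
  have h2 : |u 1 * u 1 + u 2 * u 2| ≤ 2 * ‖u‖ ^ 2 := by
    have := ((quadLip_mul 1 1).add (quadLip_mul 2 2)).abs_le u
    norm_num at this
    exact this
  calc |logLik p q u - logLik p' q' u|
      = |(p - p') * crossSum u - (q - q') * (u 1 * u 1 + u 2 * u 2)| := by
        rw [logLik, logLik]; ring_nf
    _ ≤ |p - p'| * |crossSum u| + |q - q'| * |u 1 * u 1 + u 2 * u 2| := by
        rw [← abs_mul, ← abs_mul]; exact abs_sub _ _
    _ ≤ |p - p'| * (3 * ‖u‖ ^ 2) + |q - q'| * (2 * ‖u‖ ^ 2) := by gcongr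
    _ = _ := by ring

lemma abs_logScore_sub_param_le (p q p' q' : ℝ) (u : Fin 4 → ℝ) :
    |logScore p q u - logScore p' q' u| ≤ 2 * (3 * |p - p'| + 2 * |q - q'|) * ‖u‖ ^ 2 := by
  rw [mul_assoc]
  refine abs_logScore_sub_le (abs_logLik_sub_param_le p q p' q' u) fun τ => ?_
  refine (abs_logLik_sub_param_le p q p' q' _).trans ?_
  gcongr
  exact norm_permTail_le τ u

/-- Expanding the squares isolates the factors symmetric in `x, y, z`, which cancel in the score.
Only the `logLik` factor sees the order. -/
lemma g_eq (a v w x y z : ℝ) (hv : v ≠ 0) :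
    g a v w x y z = 1 / (2 * Real.pi * v) *
      Real.exp (-(x ^ 2 + y ^ 2 + z ^ 2 + a ^ 2 * w ^ 2) / (2 * v)) *
      Real.exp (logLik (a / v) (a ^ 2 / (2 * v)) ![w, x, y, z]) := by
  rw [g, mul_assoc (1 / (2 * Real.pi * v)), ← Real.exp_add]
  congr 2
  simp only [logLik, crossSum, Matrix.cons_val]
  field_simp
  ring

lemma score_eq_exp (a v w : ℝ) (x : Fin 3 → ℝ) (hv : 0 < v) :
    score a v w x = Real.exp (logScore (a / v) (a ^ 2 / (2 * v)) ![w, x 0, x 1, x 2]) := by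
  set p := a / v
  set q := a ^ 2 / (2 * v)
  set K := 1 / (2 * Real.pi * v) *
      Real.exp (-(x 0 ^ 2 + x 1 ^ 2 + x 2 ^ 2 + a ^ 2 * w ^ 2) / (2 * v)) with hK
  have hKpos : 0 < K := by positivity
  have hτ : ∀ τ : Equiv.Perm (Fin 3), g a v w (x (τ 0)) (x (τ 1)) (x (τ 2)) =
      K * Real.exp (logLik p q (permTail τ ![w, x 0, x 1, x 2])) := by
    intro τ
    have hsum : x (τ 0) ^ 2 + x (τ 1) ^ 2 + x (τ 2) ^ 2 = x 0 ^ 2 + x 1 ^ 2 + x 2 ^ 2 := by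
      have := Equiv.sum_comp τ (fun i => x i ^ 2)
      simpa [Fin.sum_univ_three] using this
    have hvec : permTail τ ![w, x 0, x 1, x 2] = ![w, x (τ 0), x (τ 1), x (τ 2)] := by
      have hx : ∀ i : Fin 3, (![w, x 0, x 1, x 2] : Fin 4 → ℝ) i.succ = x i := by
        intro i; fin_cases i <;> rfl
      funext i
      fin_cases i
      · rfl
      · exact hx (τ 0)
      · exact hx (τ 1)
      · exact hx (τ 2)
    rw [g_eq _ _ _ _ _ _ hv.ne', hsum, hvec]
  have hpos : 0 < ∑ τ : Equiv.Perm (Fin 3),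
      Real.exp (logLik p q (permTail τ ![w, x 0, x 1, x 2])) :=
    Finset.sum_pos (fun i _ => Real.exp_pos _) Finset.univ_nonempty
  have h1 : g a v w (x 0) (x 1) (x 2) = K * Real.exp (logLik p q ![w, x 0, x 1, x 2]) :=
    g_eq _ _ _ _ _ _ hv.ne'
  rw [score, Finset.sum_congr rfl (fun τ _ => hτ τ), ← Finset.mul_sum, h1, logScore,
    Real.exp_sub, Real.exp_add, Real.exp_log hpos,
    Real.exp_log (by norm_num)]
  field_simp

/-! ### The stationary law -/

/-- The independent inputs `X 1, ε 2, ε 3, …` of the recursion. -/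
def inputs {Ω : Type*} (X ε : ℕ → Ω → ℝ) (n : ℕ) : Ω → ℝ := if n = 0 then X 1 else ε (n + 1)

section Law

variable {Ω : Type*} [MeasurableSpace Ω] {μ : Measure Ω} {a σ : ℝ} {X ε : ℕ → Ω → ℝ}

lemma IsStationaryGaussianAR1.iIndepFun_inputs (hX : IsStationaryGaussianAR1 a σ X ε μ) :
    iIndepFun (inputs X ε) μ := hX.indep

lemma IsStationaryGaussianAR1.measurable_inputs (hX : IsStationaryGaussianAR1 a σ X ε μ) (n : ℕ) :
    Measurable (inputs X ε n) := by
  cases n with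
  | zero => exact hX.measurable_X 1 le_rfl
  | succ n => exact hX.measurable_innovation _ (by omega)

lemma IsStationaryGaussianAR1.map_block_eq (hX : IsStationaryGaussianAR1 a σ X ε μ)
    {t : ℕ} (ht : 1 ≤ t) (n : ℕ) :
    μ.map (fun ω (i : Fin n) => X (t + i) ω) = μ.map (fun ω (i : Fin n) => X (1 + i) ω) := by
  obtain ⟨k, rfl⟩ := Nat.exists_eq_add_of_le' ht
  have hm : ∀ k, Measurable (fun ω (t : ℕ) => X (t + 1 + k) ω) := fun k =>
    measurable_pi_lambda _ fun t => hX.measurable_X _ (by omega)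
  have hr : Measurable (fun (x : ℕ → ℝ) (i : Fin n) => x i) :=
    measurable_pi_lambda _ fun i => measurable_pi_apply _
  have := congrArg (Measure.map (fun (x : ℕ → ℝ) (i : Fin n) => x i)) (hX.stationary k)
  rw [Measure.map_map hr (hm k), Measure.map_map hr (hm 0)] at this
  convert this using 2
  · funext ω i
    simp only [Function.comp]
    congr 1
    omega
  · funext ω i
    simp only [Function.comp]
    congr 1
    omega

lemma IsStationaryGaussianAR1.map_X_eq (hX : IsStationaryGaussianAR1 a σ X ε μ)
    {t : ℕ} (ht : 1 ≤ t) : μ.map (X t) = μ.map (X 1) := by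
  have hm : ∀ t, 1 ≤ t → Measurable (fun ω (i : Fin 1) => X (t + i) ω) := fun t ht =>
    measurable_pi_lambda _ fun i => hX.measurable_X _ (by omega)
  have := congrArg (Measure.map (fun x : Fin 1 → ℝ => x 0)) (hX.map_block_eq ht 1)
  rw [Measure.map_map (measurable_pi_apply _) (hm t ht),
    Measure.map_map (measurable_pi_apply _) (hm 1 le_rfl)] at this
  exact this

lemma charFun_gaussianReal_zero (v : ℝ) (t : ℝ) :
    charFun (gaussianReal 0 (Real.toNNReal (v ^ 2))) t =
      Complex.exp ((-(v ^ 2 * t ^ 2 / 2) : ℝ) : ℂ) := by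
  rw [charFun_gaussianReal, Real.coe_toNNReal _ (sq_nonneg v)]
  congr 1
  push_cast
  ring

lemma IsStationaryGaussianAR1.memLp_innovation (hX : IsStationaryGaussianAR1 a σ X ε μ)
    {t : ℕ} (ht : 2 ≤ t) : MemLp (ε t) 2 μ := by
  have h : MemLp id 2 (μ.map (ε t)) := by
    rw [hX.innovation_law t ht]
    exact memLp_id_gaussianReal 2
  exact h.comp_of_map (hX.measurable_innovation t ht).aemeasurable

lemma integral_sq_of_map_gaussianReal {Y : Ω → ℝ} (hY : Measurable Y) {v : ℝ}
    (h : μ.map Y = gaussianReal 0 (Real.toNNReal (v ^ 2))) : ∫ ω, Y ω ^ 2 ∂μ = v ^ 2 := by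
  have h1 : ∫ ω, Y ω ^ 2 ∂μ = ∫ x, x ^ 2 ∂(μ.map Y) :=
    (integral_map (f := fun x : ℝ => x ^ 2) hY.aemeasurable (by fun_prop)).symm
  have h2 := variance_fun_id_gaussianReal (μ := 0) (v := Real.toNNReal (v ^ 2))
  rw [variance_eq_integral (by fun_prop), integral_id_gaussianReal] at h2
  rw [h1, h]
  simpa [Real.coe_toNNReal _ (sq_nonneg v)] using h2

variable [IsProbabilityMeasure μ]

/-- `X 2` has the law of `X 1` and is the sum of the independent variables `a * X 1` and `ε 2`. -/
lemma IsStationaryGaussianAR1.charFun_eq (hX : IsStationaryGaussianAR1 a σ X ε μ) (t : ℝ) :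
    charFun (μ.map (X 1)) t =
      charFun (μ.map (X 1)) (a * t) * Complex.exp ((-(σ ^ 2 * t ^ 2 / 2) : ℝ) : ℂ) := by
  have hind : IndepFun (X 1) (ε 2) μ := by
    simpa using hX.indep.indepFun (show (0 : ℕ) ≠ 1 by norm_num)
  have m1 := hX.measurable_X 1 le_rfl
  have m2 := hX.measurable_innovation 2 le_rfl
  have h2 : μ.map (X 2) = μ.map ((fun ω => a * X 1 ω) + ε 2) :=
    Measure.map_congr (hX.recursion 1 le_rfl)
  have hind' : IndepFun (fun ω => a * X 1 ω) (ε 2) μ :=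
    hind.comp (measurable_const_mul a) measurable_id
  conv_lhs => rw [← hX.map_X_eq (t := 2) (by norm_num), h2,
    hind'.charFun_map_add_eq_mul (m1.const_mul a).aemeasurable m2.aemeasurable]
  rw [Pi.mul_apply, charFun_map_mul_comp m1.aemeasurable, hX.innovation_law 2 le_rfl,
    charFun_gaussianReal_zero]

lemma IsStationaryGaussianAR1.charFun_eq_iterate (hX : IsStationaryGaussianAR1 a σ X ε μ)
    (t : ℝ) (n : ℕ) :
    charFun (μ.map (X 1)) t = charFun (μ.map (X 1)) (a ^ n * t) *
      Complex.exp ((-(σ ^ 2 * t ^ 2 / 2) * ∑ k ∈ Finset.range n, (a ^ 2) ^ k : ℝ) : ℂ) := by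
  induction n with
  | zero => simp
  | succ n ih =>
    rw [ih, hX.charFun_eq (a ^ n * t), Finset.sum_range_succ, mul_assoc, ← Complex.exp_add,
      ← Complex.ofReal_add]
    ring_nf

/-- If `|a| ≥ 1`, the geometric sum in the iterated identity is at least `n` for every `n`. The
characteristic function then vanishes away from `0`, contradicting its continuity and its value `1`
at `0`. -/
lemma IsStationaryGaussianAR1.abs_lt_one (hX : IsStationaryGaussianAR1 a σ X ε μ) (hσ : 0 < σ) :
    |a| < 1 := by
  by_contra! ha
  have : IsProbabilityMeasure (μ.map (X 1)) :=
    Measure.isProbabilityMeasure_map (hX.measurable_X 1 le_rfl).aemeasurable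
  have ha2 : 1 ≤ a ^ 2 := by rw [← sq_abs]; nlinarith
  have hzero : ∀ t ≠ 0, charFun (μ.map (X 1)) t = 0 := by
    intro t ht
    have hb : ∀ n : ℕ, ‖charFun (μ.map (X 1)) t‖ ≤ Real.exp (-(σ ^ 2 * t ^ 2 / 2)) ^ n := by
      intro n
      rw [hX.charFun_eq_iterate t n, norm_mul, Complex.norm_exp_ofReal, ← Real.exp_nat_mul]
      have h1 : (n : ℝ) ≤ ∑ k ∈ Finset.range n, (a ^ 2) ^ k := by
        have := Finset.card_nsmul_le_sum (Finset.range n) (fun k => (a ^ 2) ^ k) 1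
          (fun k _ => one_le_pow₀ ha2)
        simpa using this
      have h2 : 0 < σ ^ 2 * t ^ 2 / 2 := by positivity
      calc _ ≤ 1 * Real.exp (-(σ ^ 2 * t ^ 2 / 2) * ∑ k ∈ Finset.range n, (a ^ 2) ^ k) := by
            gcongr; exact norm_charFun_le_one _
        _ ≤ _ := by
            rw [one_mul, Real.exp_le_exp]
            nlinarith
    have hlt : Real.exp (-(σ ^ 2 * t ^ 2 / 2)) < 1 := by
      rw [Real.exp_lt_one_iff]
      have : 0 < σ ^ 2 * t ^ 2 / 2 := by positivity
      linarith
    have := ge_of_tendsto' (tendsto_pow_atTop_nhds_zero_of_lt_one (Real.exp_pos _).le hlt) hb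
    exact norm_le_zero_iff.1 this
  have hcont : Continuous (charFun (μ.map (X 1))) := continuous_charFun
  have h0 : Tendsto (charFun (μ.map (X 1))) (𝓝[≠] 0) (𝓝 (charFun (μ.map (X 1)) 0)) :=
    (hcont.tendsto 0).mono_left nhdsWithin_le_nhds
  have h1 : Tendsto (charFun (μ.map (X 1))) (𝓝[≠] 0) (𝓝 0) := by
    refine tendsto_const_nhds.congr' ?_
    filter_upwards [self_mem_nhdsWithin] with t ht using (hzero t ht).symm
  have := tendsto_nhds_unique h0 h1
  simp [charFun_zero] at this

/-- The stationary standard deviation. -/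
def statDev (a σ : ℝ) : ℝ := Real.sqrt (σ ^ 2 / (1 - a ^ 2))

lemma statDev_sq (ha : |a| < 1) : statDev a σ ^ 2 = σ ^ 2 / (1 - a ^ 2) := by
  have : 0 < 1 - a ^ 2 := by
    have := (sq_lt_one_iff_abs_lt_one a).2 ha
    linarith
  exact Real.sq_sqrt (by positivity)

lemma statDev_pos (ha : |a| < 1) (hσ : 0 < σ) : 0 < statDev a σ := by
  have : 0 < 1 - a ^ 2 := by
    have := (sq_lt_one_iff_abs_lt_one a).2 ha
    linarith
  exact Real.sqrt_pos.2 (by positivity)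

/-- In the iterated identity let `n → ∞`: the first factor tends to the value `1` at the origin, and
the geometric sum to `1 / (1 - a ^ 2)`. -/
lemma IsStationaryGaussianAR1.map_X_one (hX : IsStationaryGaussianAR1 a σ X ε μ) (hσ : 0 < σ) :
    μ.map (X 1) = gaussianReal 0 (Real.toNNReal (statDev a σ ^ 2)) := by
  have ha := hX.abs_lt_one hσ
  have ha2 : a ^ 2 < 1 := (sq_lt_one_iff_abs_lt_one a).2 ha
  have : IsProbabilityMeasure (μ.map (X 1)) :=
    Measure.isProbabilityMeasure_map (hX.measurable_X 1 le_rfl).aemeasurable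
  refine Measure.ext_of_charFun ?_
  funext t
  rw [charFun_gaussianReal_zero]
  have hcont : Continuous (charFun (μ.map (X 1))) := continuous_charFun
  have h1 : Tendsto (fun n : ℕ => charFun (μ.map (X 1)) (a ^ n * t)) atTop (𝓝 1) := by
    have h0 : Tendsto (fun n : ℕ => a ^ n * t) atTop (𝓝 0) := by
      simpa using (tendsto_pow_atTop_nhds_zero_of_abs_lt_one ha).mul_const t
    simpa [charFun_zero, Function.comp_def] using (hcont.tendsto 0).comp h0
  have h2 : Tendsto (fun n : ℕ =>
      Complex.exp ((-(σ ^ 2 * t ^ 2 / 2) * ∑ k ∈ Finset.range n, (a ^ 2) ^ k : ℝ) : ℂ)) atTop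
      (𝓝 (Complex.exp ((-(σ ^ 2 * t ^ 2 / 2) * (1 - a ^ 2)⁻¹ : ℝ) : ℂ))) := by
    have := (hasSum_geometric_of_lt_one (sq_nonneg a) ha2).tendsto_sum_nat.const_mul
      (-(σ ^ 2 * t ^ 2 / 2))
    exact ((Complex.continuous_exp.comp Complex.continuous_ofReal).tendsto _).comp this
  have h3 := tendsto_nhds_unique (tendsto_const_nhds.congr (hX.charFun_eq_iterate t)) (h1.mul h2)
  rw [h3, one_mul, statDev_sq ha]
  congr 2
  field_simp

lemma IsStationaryGaussianAR1.memLp_X (hX : IsStationaryGaussianAR1 a σ X ε μ) (hσ : 0 < σ)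
    {t : ℕ} (ht : 1 ≤ t) : MemLp (X t) 2 μ := by
  have h : MemLp id 2 (μ.map (X t)) := by
    rw [hX.map_X_eq ht, hX.map_X_one hσ]
    exact memLp_id_gaussianReal 2
  exact h.comp_of_map (hX.measurable_X t ht).aemeasurable

lemma IsStationaryGaussianAR1.integral_X_sq (hX : IsStationaryGaussianAR1 a σ X ε μ) (hσ : 0 < σ)
    {t : ℕ} (ht : 1 ≤ t) : ∫ ω, X t ω ^ 2 ∂μ = statDev a σ ^ 2 :=
  integral_sq_of_map_gaussianReal (hX.measurable_X t ht)
    ((hX.map_X_eq ht).trans (hX.map_X_one hσ))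

lemma IsStationaryGaussianAR1.integral_X_mul (hX : IsStationaryGaussianAR1 a σ X ε μ)
    (hσ : 0 < σ) {t : ℕ} (ht : 1 ≤ t) : ∫ ω, X t ω * X (t + 1) ω ∂μ = a * statDev a σ ^ 2 := by
  have h12 : ∫ ω, X 1 ω * X 2 ω ∂μ = a * statDev a σ ^ 2 := by
    have hind : IndepFun (X 1) (ε 2) μ := by
      simpa using hX.indep.indepFun (show (0 : ℕ) ≠ 1 by norm_num)
    have m1 := hX.memLp_X hσ le_rfl
    have m2 := hX.memLp_innovation le_rfl
    have h0 : ∫ ω, ε 2 ω ∂μ = 0 := by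
      have := integral_map (μ := μ) (φ := ε 2) (f := fun x : ℝ => x)
        (hX.measurable_innovation 2 le_rfl).aemeasurable (by fun_prop)
      rw [← this, hX.innovation_law 2 le_rfl, integral_id_gaussianReal]
    have h1 : ∫ ω, X 1 ω * ε 2 ω ∂μ = 0 := by
      rw [hind.integral_fun_mul_eq_mul_integral m1.1 m2.1, h0, mul_zero]
    have hi : Integrable (fun ω => X 1 ω * ε 2 ω) μ := m1.integrable_mul m2
    calc ∫ ω, X 1 ω * X 2 ω ∂μ = ∫ ω, (a * X 1 ω ^ 2 + X 1 ω * ε 2 ω) ∂μ := by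
          refine integral_congr_ae ?_
          filter_upwards [hX.recursion 1 le_rfl] with ω hω
          rw [hω]; ring
      _ = _ := by
          rw [integral_add (m1.integrable_sq.const_mul a) hi, h1,
            integral_const_mul, hX.integral_X_sq hσ le_rfl, add_zero]
  have hm : ∀ t, 1 ≤ t → Measurable (fun ω (i : Fin 2) => X (t + i) ω) := fun t ht =>
    measurable_pi_lambda _ fun i => hX.measurable_X _ (by omega)
  have hf : ∀ t, 1 ≤ t → ∫ ω, X t ω * X (t + 1) ω ∂μ =
      ∫ x : Fin 2 → ℝ, x 0 * x 1 ∂(μ.map (fun ω (i : Fin 2) => X (t + i) ω)) := fun t ht =>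
    (integral_map (f := fun x : Fin 2 → ℝ => x 0 * x 1) (hm t ht).aemeasurable
      (by fun_prop)).symm
  rw [hf t ht, hX.map_block_eq ht, ← hf 1 le_rfl, h12]

end Law

/-! ### Paths of the recursion and their truncation -/

/-- The solution of the recursion `x (k + 1) = a * x k + v k` with `x 0 = x₀`. -/
def arPath (a x₀ : ℝ) (v : ℕ → ℝ) : ℕ → ℝ
  | 0 => x₀
  | k + 1 => a * arPath a x₀ v k + v k

lemma arPath_sub (a x₀ : ℝ) (v : ℕ → ℝ) (k : ℕ) :
    arPath a x₀ v k - arPath a 0 v k = a ^ k * x₀ := by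
  induction k with
  | zero => simp [arPath]
  | succ k ih =>
    calc _ = a * (arPath a x₀ v k - arPath a 0 v k) := by simp only [arPath]; ring
      _ = _ := by rw [ih]; ring

lemma arPath_congr (a x₀ : ℝ) {v v' : ℕ → ℝ} {k : ℕ} (h : ∀ j < k, v j = v' j) :
    arPath a x₀ v k = arPath a x₀ v' k := by
  induction k with
  | zero => rfl
  | succ k ih => simp only [arPath, ih (fun j hj => h j (by omega)), h k (by omega)]

lemma sum_range_arith_le {x : ℕ → ℝ} (hx : ∀ j, 0 ≤ x j) (c n : ℕ) :
    ∑ s ∈ Finset.range n, x (3 * s + c) ≤ ∑ j ∈ Finset.range (3 * n + c), x j := by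
  induction n with
  | zero => simpa using Finset.sum_nonneg (s := Finset.range c) fun j _ => hx j
  | succ n ih =>
    rw [Finset.sum_range_succ, show 3 * (n + 1) + c = 3 * n + c + 1 + 1 + 1 by ring,
      Finset.sum_range_succ, Finset.sum_range_succ, Finset.sum_range_succ]
    linarith [hx (3 * n + c + 1), hx (3 * n + c + 1 + 1)]

lemma norm_sq_le_sum_sq {ι : Type*} [Fintype ι] (u : ι → ℝ) : ‖u‖ ^ 2 ≤ ∑ i, u i ^ 2 := by
  have h0 : 0 ≤ ∑ i, u i ^ 2 := Finset.sum_nonneg fun i _ => sq_nonneg _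
  rw [← Real.le_sqrt (norm_nonneg _) h0, pi_norm_le_iff_of_nonneg (Real.sqrt_nonneg _)]
  intro i
  refine Real.abs_le_sqrt ?_
  exact Finset.single_le_sum (f := fun i => u i ^ 2) (fun i _ => sq_nonneg _) (Finset.mem_univ i)

lemma QuadLip.nonneg {C : ℝ} {f : (Fin 4 → ℝ) → ℝ} (hf : QuadLip C f) : 0 ≤ C := by
  have h := (abs_nonneg _).trans (hf (fun _ => 1) 0)
  simpa using h

/-- Applied with `ρ = |a| ^ k` and `r` the value at which the path is truncated. The bound uses
squares because their averages and integrals are under control; it follows from `2‖u‖|r| ≤ ‖u‖ ^ 2 +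
r ^ 2`. -/
lemma QuadLip.abs_sub_le_of_norm_sub_le {C : ℝ} {f : (Fin 4 → ℝ) → ℝ} (hf : QuadLip C f)
    {u v : Fin 4 → ℝ} {ρ r : ℝ} (hρ : 0 ≤ ρ) (hρ1 : ρ ≤ 1) (h : ‖u - v‖ ≤ ρ * |r|) :
    |f u - f v| ≤ C * ρ * (∑ i, u i ^ 2 + 2 * r ^ 2) := by
  have hC := hf.nonneg
  have hr := abs_nonneg r
  have h1 : ‖u - v‖ ≤ |r| := h.trans (by nlinarith)
  have h2 : ‖v‖ ≤ ‖u‖ + |r| := by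
    have := norm_sub_le u (u - v)
    rw [sub_sub_cancel] at this
    linarith
  have h3 := norm_sq_le_sum_sq u
  calc |f u - f v| ≤ C * (‖u - v‖ * (‖u‖ + ‖v‖)) := hf u v
    _ ≤ C * (ρ * |r| * (‖u‖ + (‖u‖ + |r|))) := by gcongr
    _ = C * ρ * (2 * ‖u‖ * |r| + |r| ^ 2) := by ring
    _ ≤ C * ρ * (∑ i, u i ^ 2 + 2 * r ^ 2) := by
      refine mul_le_mul_of_nonneg_left ?_ (by positivity)
      rw [← sq_abs r]
      nlinarith [two_mul_le_add_sq ‖u‖ |r|]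

/-- Four successive values of the process, starting at time `t`. -/
def block {Ω : Type*} (X : ℕ → Ω → ℝ) (t : ℕ) (ω : Ω) : Fin 4 → ℝ := fun i => X (t + i) ω

/-- Four successive values of the autoregression started from `0`, after `k` steps, as a function
of the innovations. -/
def truncBlock (a : ℝ) (k : ℕ) (v : Fin (k + 3) → ℝ) : Fin 4 → ℝ :=
  fun i => arPath a 0 (fun j => if h : j < k + 3 then v ⟨j, h⟩ else 0) (k + i)

lemma measurable_truncBlock (a : ℝ) (k : ℕ) : Measurable (truncBlock a k) := by
  have h : ∀ l, Measurable fun v : Fin (k + 3) → ℝ =>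
      arPath a 0 (fun j => if h : j < k + 3 then v ⟨j, h⟩ else 0) l := by
    intro l
    induction l with
    | zero => exact measurable_const
    | succ l ih =>
      refine (ih.const_mul a).add ?_
      by_cases hl : l < k + 3
      · simpa [hl] using measurable_pi_apply _
      · simp [hl]
  exact measurable_pi_lambda _ fun i => h _

lemma truncBlock_apply (a : ℝ) (k : ℕ) (v : ℕ → ℝ) (i : Fin 4) :
    truncBlock a k (fun j => v j) i = arPath a 0 v (k + i) := by
  refine arPath_congr a 0 fun j hj => ?_
  -- The path at time `k + i ≤ k + 3` reads only inputs of index below `k + 3`, so the default value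
  -- `0` is never reached.
  rw [dif_pos (by omega)]

/-! ### Strong law for blocks of the process -/

section Ergodic

variable {Ω : Type*} [MeasurableSpace Ω] {μ : Measure Ω} {a σ : ℝ} {X ε : ℕ → Ω → ℝ}

lemma IsStationaryGaussianAR1.measurable_block (hX : IsStationaryGaussianAR1 a σ X ε μ) {t : ℕ}
    (ht : 1 ≤ t) : Measurable (block X t) :=
  measurable_pi_lambda _ fun _ => hX.measurable_X _ (by omega)

/-- The innovations entering `X (n + 1), …, X (n + K)`. -/
def window {Ω : Type*} (X ε : ℕ → Ω → ℝ) (K n : ℕ) (ω : Ω) : Fin K → ℝ :=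
  fun i => inputs X ε (n + i) ω

lemma IsStationaryGaussianAR1.measurable_window (hX : IsStationaryGaussianAR1 a σ X ε μ)
    (K n : ℕ) : Measurable (window X ε K n) :=
  measurable_pi_lambda _ fun _ => hX.measurable_inputs _

lemma IsStationaryGaussianAR1.map_inputs (hX : IsStationaryGaussianAR1 a σ X ε μ) {n : ℕ}
    (hn : 1 ≤ n) : μ.map (inputs X ε n) = gaussianReal 0 (Real.toNNReal (σ ^ 2)) := by
  rw [inputs, if_neg (by omega)]
  exact hX.innovation_law _ (by omega)

lemma IsStationaryGaussianAR1.memLp_inputs (hX : IsStationaryGaussianAR1 a σ X ε μ) {n : ℕ}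
    (hn : 1 ≤ n) : MemLp (inputs X ε n) 2 μ := by
  rw [inputs, if_neg (by omega)]
  exact hX.memLp_innovation (by omega)

lemma IsStationaryGaussianAR1.map_window (hX : IsStationaryGaussianAR1 a σ X ε μ) (K : ℕ) {n : ℕ}
    (hn : 1 ≤ n) : μ.map (window X ε K n) =
      Measure.pi (fun _ : Fin K => gaussianReal 0 (Real.toNNReal (σ ^ 2))) := by
  have hinj : Function.Injective (fun i : Fin K => n + (i : ℕ)) := fun i j hij =>
    Fin.ext (Nat.add_left_cancel hij)
  have := (hX.iIndepFun_inputs.precomp hinj).map_fun_eq_pi_map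
    (fun i => (hX.measurable_inputs _).aemeasurable)
  refine this.trans ?_
  congr 1
  funext i
  exact hX.map_inputs (by omega)

lemma IsStationaryGaussianAR1.indepFun_window (hX : IsStationaryGaussianAR1 a σ X ε μ)
    {K K' n m : ℕ} (h : n + K ≤ m) : IndepFun (window X ε K n) (window X ε K' m) μ := by
  have hdisj : Disjoint (Finset.Ico n (n + K)) (Finset.Ico m (m + K')) := by
    rw [Finset.disjoint_left]
    intro x hx hx'
    rw [Finset.mem_Ico] at hx hx'
    omega
  have := hX.iIndepFun_inputs.indepFun_finset _ _ hdisj hX.measurable_inputs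
  let φ : ∀ K n, (Finset.Ico n (n + K) → ℝ) → (Fin K → ℝ) := fun K n x i =>
    x ⟨n + i, Finset.mem_Ico.2 ⟨by omega, by omega⟩⟩
  have hφ : ∀ K n, Measurable (φ K n) := fun K n =>
    measurable_pi_lambda _ fun i => measurable_pi_apply _
  exact this.comp (hφ K n) (hφ K' m)

lemma IsStationaryGaussianAR1.eq_arPath (hX : IsStationaryGaussianAR1 a σ X ε μ) :
    ∀ᵐ ω ∂μ, ∀ n k : ℕ, 1 ≤ n →
      X (n + k) ω = arPath a (X n ω) (fun j => inputs X ε (n + j) ω) k := by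
  have hrec : ∀ᵐ ω ∂μ, ∀ t : ℕ, 1 ≤ t → X (t + 1) ω = a * X t ω + ε (t + 1) ω := by
    rw [ae_all_iff]
    intro t
    by_cases ht : 1 ≤ t
    · filter_upwards [hX.recursion t ht] with ω hω _ using hω
    · exact Eventually.of_forall fun ω h => absurd h ht
  filter_upwards [hrec] with ω hω n k hn
  induction k with
  | zero => rfl
  | succ k ih =>
    rw [arPath, ← ih, ← add_assoc, hω (n + k) (by omega), inputs, if_neg (by omega)]

lemma integrable_comp_of_quadLip [IsProbabilityMeasure μ] {C : ℝ} {f : (Fin 4 → ℝ) → ℝ}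
    (hf : QuadLip C f) {Y : Ω → Fin 4 → ℝ} (hY : ∀ i, MemLp (fun ω => Y ω i) 2 μ) :
    Integrable (fun ω => f (Y ω)) μ := by
  have hYm : AEMeasurable Y μ := aemeasurable_pi_lambda _ fun i => (hY i).1.aemeasurable
  have hint : Integrable (fun ω => |f 0| + C * ∑ i, Y ω i ^ 2) μ :=
    (integrable_const _).add ((integrable_finsetSum _ fun i _ => (hY i).integrable_sq).const_mul C)
  refine hint.mono' (hf.continuous.measurable.comp_aemeasurable hYm).aestronglyMeasurable ?_
  refine Eventually.of_forall fun ω => ?_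
  have h1 := hf.abs_le (Y ω)
  have h2 := mul_le_mul_of_nonneg_left (norm_sq_le_sum_sq (Y ω)) hf.nonneg
  have h3 := abs_add_le (f (Y ω) - f 0) (f 0)
  rw [sub_add_cancel] at h3
  rw [Real.norm_eq_abs]
  linarith

lemma IsStationaryGaussianAR1.integral_comp_block (hX : IsStationaryGaussianAR1 a σ X ε μ)
    {f : (Fin 4 → ℝ) → ℝ} (hf : Continuous f) {t : ℕ} (ht : 1 ≤ t) :
    ∫ ω, f (block X t ω) ∂μ = ∫ ω, f (block X 1 ω) ∂μ := by
  have h : ∀ t, 1 ≤ t → ∫ ω, f (block X t ω) ∂μ = ∫ u, f u ∂(μ.map (block X t)) := fun t ht =>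
    (integral_map (hX.measurable_block ht).aemeasurable hf.aestronglyMeasurable).symm
  rw [h t ht, h 1 le_rfl]
  congr 1
  exact hX.map_block_eq ht 4

variable [IsProbabilityMeasure μ]

lemma IsStationaryGaussianAR1.memLp_truncBlock (hX : IsStationaryGaussianAR1 a σ X ε μ) {n : ℕ}
    (hn : 1 ≤ n) (k : ℕ) (i : Fin 4) :
    MemLp (fun ω => truncBlock a k (window X ε (k + 3) n ω) i) 2 μ := by
  have h : ∀ l, MemLp (fun ω => arPath a 0 (fun j => inputs X ε (n + j) ω) l) 2 μ := by
    intro l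
    induction l with
    | zero => exact memLp_const 0
    | succ l ih => exact (ih.const_mul a).add (hX.memLp_inputs (by omega))
  refine (h (k + i)).congr_norm ?_ ?_
  · exact ((measurable_pi_apply i).comp
      ((measurable_truncBlock a k).comp (hX.measurable_window _ n))).aestronglyMeasurable
  · refine Eventually.of_forall fun ω => ?_
    rw [← truncBlock_apply]
    rfl

lemma IsStationaryGaussianAR1.norm_block_sub_truncBlock_le
    (hX : IsStationaryGaussianAR1 a σ X ε μ) (hσ : 0 < σ) :
    ∀ᵐ ω ∂μ, ∀ n k : ℕ, 1 ≤ n →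
      ‖block X (n + k) ω - truncBlock a k (window X ε (k + 3) n ω)‖ ≤ |a| ^ k * |X n ω| := by
  have ha := hX.abs_lt_one hσ
  filter_upwards [hX.eq_arPath] with ω hω n k hn
  refine (pi_norm_le_iff_of_nonneg (by positivity)).2 fun i => ?_
  have h1 : truncBlock a k (window X ε (k + 3) n ω) i =
      arPath a 0 (fun j => inputs X ε (n + j) ω) (k + i) :=
    truncBlock_apply a k (fun j => inputs X ε (n + j) ω) i
  rw [Pi.sub_apply, h1, block, add_assoc, hω n (k + i) hn, arPath_sub, Real.norm_eq_abs, abs_mul,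
    abs_pow]
  gcongr ?_ * _
  exact pow_le_pow_of_le_one (abs_nonneg a) ha.le (Nat.le_add_right _ _)

/-- The windows start at multiples of 3 and have length `3 * (m + 1)`, so those whose indices `s`
differ by at least `m + 1` are disjoint. Along each residue class mod `m + 1` the terms are pairwise
independent and identically distributed, and the strong law applies. -/
lemma IsStationaryGaussianAR1.tendsto_average_truncBlock (hX : IsStationaryGaussianAR1 a σ X ε μ)
    {C : ℝ} {f : (Fin 4 → ℝ) → ℝ} (hf : QuadLip C f) (m : ℕ) :
    ∀ᵐ ω ∂μ, Tendsto (fun n : ℕ => (∑ s ∈ Finset.range n,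
        f (truncBlock a (3 * m) (window X ε (3 * m + 3) (3 * (s + 1)) ω))) / n) atTop
      (𝓝 (∫ ω, f (truncBlock a (3 * m) (window X ε (3 * m + 3) 3 ω)) ∂μ)) := by
  set F : (Fin (3 * m + 3) → ℝ) → ℝ := fun v => f (truncBlock a (3 * m) v) with hF
  have hFm : Measurable F := hf.continuous.measurable.comp (measurable_truncBlock a _)
  have hwin : ∀ n, 1 ≤ n → IdentDistrib (window X ε (3 * m + 3) n) (window X ε (3 * m + 3) 3) μ μ :=
    fun n hn => ⟨(hX.measurable_window _ _).aemeasurable, (hX.measurable_window _ _).aemeasurable,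
      (hX.map_window _ hn).trans (hX.map_window _ (by norm_num)).symm⟩
  have hr : ∀ r : ℕ, ∀ᵐ ω ∂μ, Tendsto (fun n : ℕ => (∑ j ∈ Finset.range n,
      F (window X ε (3 * m + 3) (3 * (r + (m + 1) * j + 1)) ω)) / n) atTop
      (𝓝 (∫ ω, F (window X ε (3 * m + 3) 3 ω) ∂μ)) := by
    intro r
    have hid : ∀ j : ℕ, IdentDistrib
        (fun ω => F (window X ε (3 * m + 3) (3 * (r + (m + 1) * j + 1)) ω))
        (fun ω => F (window X ε (3 * m + 3) 3 ω)) μ μ := fun j =>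
      (hwin _ (by omega)).comp hFm
    have hlt : ∀ i j : ℕ, i < j → IndepFun
        (fun ω => F (window X ε (3 * m + 3) (3 * (r + (m + 1) * i + 1)) ω))
        (fun ω => F (window X ε (3 * m + 3) (3 * (r + (m + 1) * j + 1)) ω)) μ := by
      intro i j hij
      refine (hX.indepFun_window ?_).comp hFm hFm
      have := Nat.mul_le_mul_left (m + 1) (Nat.succ_le_of_lt hij)
      rw [Nat.succ_eq_add_one, mul_add] at this
      omega
    have := strong_law_ae_real
      (fun j ω => F (window X ε (3 * m + 3) (3 * (r + (m + 1) * j + 1)) ω))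
      (integrable_comp_of_quadLip hf fun i => hX.memLp_truncBlock (by omega) _ i)
      (fun i j hij => by
        rcases lt_or_gt_of_ne hij with h | h
        · exact hlt i j h
        · exact (hlt j i h).symm)
      (fun i => (hid i).trans (hid 0).symm)
    rwa [(hid 0).integral_eq] at this
  filter_upwards [ae_all_iff.2 hr] with ω hω
  exact tendsto_average_of_residues (L := m + 1) (Nat.succ_pos m) fun r _ => hω r

/-- The strong law for blocks needs this bound, so it is taken directly from the recursion: a
contraction inequality for the squares is summed and the `|a|` part absorbed on the left. The strong
law for the squared innovations bounds the rest. -/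
lemma IsStationaryGaussianAR1.sum_block_sq_le (hX : IsStationaryGaussianAR1 a σ X ε μ)
    (hσ : 0 < σ) :
    ∀ᵐ ω ∂μ, ∃ B, ∀ᶠ n : ℕ in atTop,
      ∑ s ∈ Finset.range n, ∑ i, block X (3 * (s + 1)) ω i ^ 2 ≤ B * n := by
  have ha := hX.abs_lt_one hσ
  have hsl : ∀ᵐ ω ∂μ, Tendsto (fun n : ℕ => (∑ j ∈ Finset.range n, inputs X ε (j + 1) ω ^ 2) / n)
      atTop (𝓝 (∫ ω, inputs X ε (0 + 1) ω ^ 2 ∂μ)) := by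
    refine strong_law_ae_real (fun j ω => inputs X ε (j + 1) ω ^ 2)
      (hX.memLp_inputs (by omega)).integrable_sq (fun i j hij => ?_) (fun i => ?_)
    · exact (hX.iIndepFun_inputs.indepFun (by simpa using hij : i + 1 ≠ j + 1)).comp
        (measurable_id.pow_const 2) (measurable_id.pow_const 2)
    · have : IdentDistrib (inputs X ε (i + 1)) (inputs X ε (0 + 1)) μ μ :=
        ⟨(hX.measurable_inputs _).aemeasurable, (hX.measurable_inputs _).aemeasurable,
          (hX.map_inputs (by omega)).trans (hX.map_inputs (by omega)).symm⟩
      exact this.comp (measurable_id.pow_const 2)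
  filter_upwards [hsl, hX.eq_arPath] with ω hω hpath
  set E : ℕ → ℝ := fun n => ∑ j ∈ Finset.range n, inputs X ε (j + 1) ω ^ 2 with hE
  set S : ℕ → ℝ := fun n => ∑ j ∈ Finset.range n, X (j + 1) ω ^ 2 with hS
  set L := ∫ ω, inputs X ε (0 + 1) ω ^ 2 ∂μ
  have hb : 0 < 1 - |a| := by linarith
  -- Convexity of the square: `a x + e` is the combination, with weights `|a|` and `1 - |a|`, of
  -- `±x` and `e / (1 - |a|)`.
  have hstep : ∀ j, X (j + 2) ω ^ 2 ≤
      |a| * X (j + 1) ω ^ 2 + (1 - |a|)⁻¹ * inputs X ε (j + 1) ω ^ 2 := by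
    intro j
    have h1 : X (j + 2) ω = a * X (j + 1) ω + inputs X ε (j + 1) ω := by
      have := hpath (j + 1) 1 (by omega)
      simpa [arPath] using this
    set x := X (j + 1) ω
    set e := inputs X ε (j + 1) ω
    rw [h1, ← sub_nonneg]
    have h2 : |a| * x ^ 2 + (1 - |a|)⁻¹ * e ^ 2 - (a * x + e) ^ 2 =
        (1 - |a|)⁻¹ * (|a| * ((1 - |a|) ^ 2 * x ^ 2 + e ^ 2) - 2 * (1 - |a|) * (a * x * e)) := by
      field_simp
      have : a ^ 2 = |a| ^ 2 := (sq_abs a).symm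
      linear_combination (-x ^ 2 * (1 - |a|)) * this
    rw [h2]
    refine mul_nonneg (by positivity) ?_
    have h3 : a * x * e ≤ |a| * (|x| * |e|) := by
      rw [← abs_mul, ← abs_mul, ← mul_assoc]; exact le_abs_self _
    have h4 : 0 ≤ |a| * ((1 - |a|) * |x| - |e|) ^ 2 := by positivity
    rw [← sq_abs x, ← sq_abs e]
    nlinarith
  have hSle : ∀ n, S n ≤ (1 - |a|)⁻¹ * (X 1 ω ^ 2 + (1 - |a|)⁻¹ * E n) := by
    intro n
    have h1 : S n ≤ X 1 ω ^ 2 + ∑ j ∈ Finset.range n, X (j + 2) ω ^ 2 := by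
      have h2 : S (n + 1) = ∑ j ∈ Finset.range n, X (j + 2) ω ^ 2 + X 1 ω ^ 2 :=
        Finset.sum_range_succ' _ n
      have h3 : S (n + 1) = S n + X (n + 1) ω ^ 2 := Finset.sum_range_succ _ n
      linarith [sq_nonneg (X (n + 1) ω)]
    have h2 : ∑ j ∈ Finset.range n, X (j + 2) ω ^ 2 ≤ |a| * S n + (1 - |a|)⁻¹ * E n := by
      rw [hS, hE, Finset.mul_sum, Finset.mul_sum, ← Finset.sum_add_distrib]
      exact Finset.sum_le_sum fun j _ => hstep j
    rw [← div_eq_inv_mul, le_div_iff₀ hb]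
    linarith
  have hEle : ∀ᶠ n : ℕ in atTop, E n ≤ (L + 1) * n := by
    filter_upwards [hω.eventually_lt_const (lt_add_one L), eventually_gt_atTop 0] with n hn hn0
    exact ((div_lt_iff₀ (by exact_mod_cast hn0)).1 hn).le
  set B₀ := (1 - |a|)⁻¹ * (X 1 ω ^ 2 + (1 - |a|)⁻¹ * |L + 1|) with hB₀
  have hB₀0 : 0 ≤ B₀ := by positivity
  have hSB : ∀ᶠ n : ℕ in atTop, S n ≤ B₀ * n := by
    filter_upwards [hEle, eventually_gt_atTop 0] with n hn hn0
    have hn1 : (1 : ℝ) ≤ n := by exact_mod_cast hn0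
    calc S n ≤ (1 - |a|)⁻¹ * (X 1 ω ^ 2 + (1 - |a|)⁻¹ * E n) := hSle n
      _ ≤ (1 - |a|)⁻¹ * (X 1 ω ^ 2 * n + (1 - |a|)⁻¹ * (|L + 1| * n)) := by
        gcongr
        · nlinarith [sq_nonneg (X 1 ω)]
        · exact hn.trans (by gcongr; exact le_abs_self _)
      _ = _ := by rw [hB₀]; ring
  have hSmono : Monotone S := monotone_nat_of_le_succ fun n => by
    have h3 : S (n + 1) = S n + X (n + 1) ω ^ 2 := Finset.sum_range_succ _ n
    linarith [sq_nonneg (X (n + 1) ω)]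
  -- There are four coordinates, each a subsum of the squares of `X 1, …, X (3n+5)`, and `3n + 5 ≤
  -- 8n` for `n ≥ 1`.
  refine ⟨4 * (B₀ * 8), ?_⟩
  have htend : Tendsto (fun n : ℕ => 3 * n + 5) atTop atTop :=
    tendsto_atTop_mono (fun n => by show n ≤ 3 * n + 5; omega) tendsto_id
  filter_upwards [htend.eventually hSB, eventually_gt_atTop 0] with n hn hn0
  have hn1 : (1 : ℝ) ≤ n := by exact_mod_cast hn0
  rw [Finset.sum_comm]
  have hi : ∀ i : Fin 4, ∑ s ∈ Finset.range n, block X (3 * (s + 1)) ω i ^ 2 ≤ B₀ * 8 * n := by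
    intro i
    calc ∑ s ∈ Finset.range n, block X (3 * (s + 1)) ω i ^ 2
        = ∑ s ∈ Finset.range n, X (3 * s + (i + 2) + 1) ω ^ 2 := by
          refine Finset.sum_congr rfl fun s _ => ?_
          rw [block, show 3 * (s + 1) + (i : ℕ) = 3 * s + (i + 2) + 1 by ring]
      _ ≤ S (3 * n + (i + 2)) :=
          sum_range_arith_le (x := fun j => X (j + 1) ω ^ 2) (fun j => sq_nonneg _) (i + 2) n
      _ ≤ S (3 * n + 5) := hSmono (by omega)
      _ ≤ B₀ * ((3 * n + 5 : ℕ) : ℝ) := hn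
      _ ≤ B₀ * (8 * n) := by
          gcongr
          push_cast
          linarith
      _ = B₀ * 8 * n := by ring
  calc _ ≤ ∑ i : Fin 4, B₀ * 8 * n := Finset.sum_le_sum fun i _ => hi i
    _ = _ := by simp; ring

lemma IsStationaryGaussianAR1.memLp_block (hX : IsStationaryGaussianAR1 a σ X ε μ) (hσ : 0 < σ)
    {t : ℕ} (ht : 1 ≤ t) (i : Fin 4) : MemLp (fun ω => block X t ω i) 2 μ :=
  hX.memLp_X hσ (by omega)

/-- By stationarity the block at time `1` may be replaced by the one at `3 + k`, which the
truncation approximates. The factor `6` counts four squared coordinates and twice the square of `X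
3`. -/
lemma IsStationaryGaussianAR1.abs_integral_truncBlock_sub_le
    (hX : IsStationaryGaussianAR1 a σ X ε μ) (hσ : 0 < σ) {C : ℝ} {f : (Fin 4 → ℝ) → ℝ}
    (hf : QuadLip C f) (k : ℕ) :
    |∫ ω, f (truncBlock a k (window X ε (k + 3) 3 ω)) ∂μ - ∫ ω, f (block X 1 ω) ∂μ| ≤
      C * |a| ^ k * (6 * statDev a σ ^ 2) := by
  have ha := hX.abs_lt_one hσ
  have hint1 := integrable_comp_of_quadLip hf (hX.memLp_truncBlock (n := 3) (by norm_num) k)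
  have hint2 := integrable_comp_of_quadLip hf
    (fun i => hX.memLp_block hσ (t := 3 + k) (by omega) i)
  have hsq : ∀ t, 1 ≤ t → Integrable (fun ω => X t ω ^ 2) μ := fun t ht =>
    (hX.memLp_X hσ ht).integrable_sq
  have hsum : Integrable (fun ω => ∑ i, block X (3 + k) ω i ^ 2) μ :=
    integrable_finsetSum _ fun i _ => hsq _ (by omega)
  rw [← hX.integral_comp_block hf.continuous (t := 3 + k) (by omega), abs_sub_comm,
    ← integral_sub hint2 hint1]
  calc _ ≤ ∫ ω, |f (block X (3 + k) ω) - f (truncBlock a k (window X ε (k + 3) 3 ω))| ∂μ :=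
        abs_integral_le_integral_abs
    _ ≤ ∫ ω, C * |a| ^ k * (∑ i, block X (3 + k) ω i ^ 2 + 2 * X 3 ω ^ 2) ∂μ := by
        refine integral_mono_ae (hint2.sub hint1).abs
          ((hsum.add ((hsq 3 (by norm_num)).const_mul 2)).const_mul _) ?_
        filter_upwards [hX.norm_block_sub_truncBlock_le hσ] with ω hω
        exact hf.abs_sub_le_of_norm_sub_le (by positivity)
          (pow_le_one₀ (abs_nonneg a) ha.le) (hω 3 k (by norm_num))
    _ = _ := by
        rw [integral_const_mul, integral_add hsum ((hsq 3 (by norm_num)).const_mul 2),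
          integral_finsetSum _ (fun i _ => (hX.memLp_block hσ (by omega) i).integrable_sq),
          integral_const_mul,
          hX.integral_X_sq hσ (by norm_num)]
        have : ∀ i : Fin 4, ∫ ω, block X (3 + k) ω i ^ 2 ∂μ = statDev a σ ^ 2 := fun i =>
          hX.integral_X_sq hσ (by omega)
        simp only [this]
        simp
        left
        ring

/-- Strong law of large numbers for functions of disjoint consecutive blocks. -/
lemma IsStationaryGaussianAR1.tendsto_average_block (hX : IsStationaryGaussianAR1 a σ X ε μ)
    (hσ : 0 < σ) {C : ℝ} {f : (Fin 4 → ℝ) → ℝ} (hf : QuadLip C f) :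
    ∀ᵐ ω ∂μ, Tendsto (fun n : ℕ => (∑ s ∈ Finset.range n, f (block X (3 * (s + 1)) ω)) / n) atTop
      (𝓝 (∫ ω, f (block X 1 ω) ∂μ)) := by
  have ha := hX.abs_lt_one hσ
  have hC := hf.nonneg
  filter_upwards [ae_all_iff.2 (hX.tendsto_average_truncBlock hf), hX.sum_block_sq_le hσ,
    hX.norm_block_sub_truncBlock_le hσ] with ω hω hB hn
  obtain ⟨B, hB⟩ := hB
  refine tendsto_average_of_approx fun η hη => ?_
  -- The first summand pays for the bias of the truncated mean, and `3 * |B|` for the pathwise error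
  -- `q (m + j) + 2 * q j`.
  have hlim : Tendsto (fun m : ℕ => C * |a| ^ (3 * m) * (6 * statDev a σ ^ 2 + 3 * |B|)) atTop
      (𝓝 0) := by
    have h1 : Tendsto (fun m : ℕ => |a| ^ (3 * m)) atTop (𝓝 0) :=
      (tendsto_pow_atTop_nhds_zero_of_lt_one (abs_nonneg a) ha).comp
        (tendsto_atTop_mono (fun n => by show n ≤ 3 * n; omega) tendsto_id)
    simpa using (h1.const_mul C).mul_const (6 * statDev a σ ^ 2 + 3 * |B|)
  obtain ⟨m, hm⟩ := (hlim.eventually_lt_const hη).exists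
  have hm1 : 0 ≤ C * |a| ^ (3 * m) * (6 * statDev a σ ^ 2) := by positivity
  have hm2 : 0 ≤ C * |a| ^ (3 * m) * (3 * |B|) := by positivity
  set y : ℕ → ℝ := fun s => f (block X (3 * (s + 1)) ω) with hy
  set z : ℕ → ℝ := fun s => f (truncBlock a (3 * m) (window X ε (3 * m + 3) (3 * (s + 1)) ω))
    with hz
  set q : ℕ → ℝ := fun s => ∑ i, block X (3 * (s + 1)) ω i ^ 2 with hq
  have hq0 : ∀ s, 0 ≤ q s := fun s => Finset.sum_nonneg fun i _ => sq_nonneg _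
  -- Block `s ≥ m` is matched with the window that starts `3 * m` steps before it, hence the index
  -- `s - m`. The first `m` terms are copied and contribute no error.
  refine ⟨fun s => if s < m then y s else z (s - m), _, tendsto_average_shift m ?_,
    (hX.abs_integral_truncBlock_sub_le hσ hf (3 * m)).trans (by linarith), ?_⟩
  · refine (hω m).congr fun n => ?_
    simp [hz]
  · have hyz : ∀ j, |y (m + j) - z j| ≤ C * |a| ^ (3 * m) * (q (m + j) + 2 * q j) := by
      intro j
      have h1 := hn (3 * (j + 1)) (3 * m) (by omega)
      rw [show 3 * (j + 1) + 3 * m = 3 * (m + j + 1) by ring] at h1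
      refine (hf.abs_sub_le_of_norm_sub_le (by positivity)
        (pow_le_one₀ (abs_nonneg a) ha.le) h1).trans ?_
      gcongr
      -- The starting value of the truncated path is coordinate `0` of block `j`, so its square is
      -- at most `q j`.
      have := Finset.single_le_sum (f := fun i => block X (3 * (j + 1)) ω i ^ 2)
        (fun i _ => sq_nonneg _) (Finset.mem_univ 0)
      simpa [block, hq] using this
    filter_upwards [hB, eventually_ge_atTop m] with n hBn hmn
    obtain ⟨k, rfl⟩ := Nat.exists_eq_add_of_le hmn
    have hsplit : ∀ x : ℕ → ℝ, ∑ j ∈ Finset.range (m + k), x j =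
        ∑ j ∈ Finset.range m, x j + ∑ j ∈ Finset.range k, x (m + j) :=
      fun x => Finset.sum_range_add x m k
    have h1 : ∑ j ∈ Finset.range m, (if j < m then y j else z (j - m)) =
        ∑ j ∈ Finset.range m, y j :=
      Finset.sum_congr rfl fun j hj => if_pos (Finset.mem_range.1 hj)
    have h2 : ∑ j ∈ Finset.range k, (if m + j < m then y (m + j) else z (m + j - m)) =
        ∑ j ∈ Finset.range k, z j := Finset.sum_congr rfl fun j _ => by simp
    have h3 : ∑ j ∈ Finset.range k, q (m + j) ≤ ∑ j ∈ Finset.range (m + k), q j := by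
      rw [hsplit q]
      linarith [Finset.sum_nonneg (s := Finset.range m) fun j _ => hq0 j]
    have h4 : ∑ j ∈ Finset.range k, q j ≤ ∑ j ∈ Finset.range (m + k), q j :=
      Finset.sum_le_sum_of_subset_of_nonneg (Finset.range_subset_range.2 (by omega))
        fun j _ _ => hq0 j
    rw [hsplit y, hsplit, h1, h2, add_sub_add_left_eq_sub, ← Finset.sum_sub_distrib]
    calc _ ≤ ∑ j ∈ Finset.range k, |y (m + j) - z j| := Finset.abs_sum_le_sum_abs _ _
      _ ≤ ∑ j ∈ Finset.range k, C * |a| ^ (3 * m) * (q (m + j) + 2 * q j) :=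
          Finset.sum_le_sum fun j _ => hyz j
      _ = C * |a| ^ (3 * m) *
          (∑ j ∈ Finset.range k, q (m + j) + 2 * ∑ j ∈ Finset.range k, q j) := by
          rw [← Finset.mul_sum, Finset.sum_add_distrib, Finset.mul_sum]
      _ ≤ C * |a| ^ (3 * m) * (3 * (|B| * ((m + k : ℕ) : ℝ))) := by
          gcongr
          have : B * ((m + k : ℕ) : ℝ) ≤ |B| * ((m + k : ℕ) : ℝ) := by
            gcongr; exact le_abs_self _
          linarith
      _ = C * |a| ^ (3 * m) * (3 * |B|) * ((m + k : ℕ) : ℝ) := by ring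
      _ ≤ η * ((m + k : ℕ) : ℝ) := by
          gcongr
          linarith

end Ergodic

/-! ### Consistency and nondegeneracy of the estimators -/

/-- Sums over `1, …, 3 (n + 1)` of functions of successive pairs, grouped into blocks. -/
lemma sum_Icc_two_eq_sum_block (h : ℕ → ℝ) (n : ℕ) :
    ∑ i ∈ Finset.Icc 2 (3 * (n + 1)), h i = h 2 + h 3 +
      ∑ s ∈ Finset.range n, (h (3 * (s + 1) + 1) + h (3 * (s + 1) + 2) + h (3 * (s + 1) + 3)) := by
  induction n with
  | zero =>
    rw [show 3 * (0 + 1) = 2 + 1 by rfl, Finset.sum_Icc_succ_top (by norm_num)]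
    simp
  | succ n ih =>
    rw [show 3 * (n + 1 + 1) = 3 * (n + 1) + 1 + 1 + 1 by ring,
      Finset.sum_Icc_succ_top (by omega), Finset.sum_Icc_succ_top (by omega),
      Finset.sum_Icc_succ_top (by omega), ih, Finset.sum_range_succ]
    ring

section Estimators

variable {Ω : Type*}

lemma sum_mul_eq_sum_crossSum (X : ℕ → Ω → ℝ) (n : ℕ) (ω : Ω) :
    ∑ i ∈ Finset.Icc 2 (3 * (n + 1)), X i ω * X (i - 1) ω =
      X 2 ω * X 1 ω + X 3 ω * X 2 ω +
        ∑ s ∈ Finset.range n, crossSum (block X (3 * (s + 1)) ω) := by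
  rw [sum_Icc_two_eq_sum_block (fun i => X i ω * X (i - 1) ω)]
  congr 1
  refine Finset.sum_congr rfl fun s _ => ?_
  simp [crossSum, block]
  ring

lemma sum_sq_eq_sum_block (X : ℕ → Ω → ℝ) (n : ℕ) (ω : Ω) :
    ∑ i ∈ Finset.Icc 2 (3 * (n + 1)), X i ω ^ 2 = X 2 ω ^ 2 + X 3 ω ^ 2 +
      ∑ s ∈ Finset.range n, (block X (3 * (s + 1)) ω 1 * block X (3 * (s + 1)) ω 1 +
        block X (3 * (s + 1)) ω 2 * block X (3 * (s + 1)) ω 2 +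
        block X (3 * (s + 1)) ω 3 * block X (3 * (s + 1)) ω 3) := by
  rw [sum_Icc_two_eq_sum_block (fun i => X i ω ^ 2)]
  congr 1
  refine Finset.sum_congr rfl fun s _ => ?_
  simp [block]
  ring

lemma sum_lag_sq_eq_sum_block (X : ℕ → Ω → ℝ) (n : ℕ) (ω : Ω) :
    ∑ i ∈ Finset.Icc 2 (3 * (n + 1)), X (i - 1) ω ^ 2 = X 1 ω ^ 2 + X 2 ω ^ 2 +
      ∑ s ∈ Finset.range n, (block X (3 * (s + 1)) ω 0 * block X (3 * (s + 1)) ω 0 +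
        block X (3 * (s + 1)) ω 1 * block X (3 * (s + 1)) ω 1 +
        block X (3 * (s + 1)) ω 2 * block X (3 * (s + 1)) ω 2) := by
  rw [sum_Icc_two_eq_sum_block (fun i => X (i - 1) ω ^ 2)]
  congr 1
  refine Finset.sum_congr rfl fun s _ => ?_
  simp [block]
  ring

lemma sum_Icc_one_pred_eq (h : ℕ → ℝ) (m : ℕ) :
    ∑ i ∈ Finset.Icc 1 (m - 1), h i = ∑ i ∈ Finset.Icc 2 m, h (i - 1) := by
  refine Finset.sum_bij (fun i _ => i + 1) (fun i hi => ?_) (fun i _ j _ hij => ?_)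
    (fun i hi => ?_) (fun i _ => ?_)
  · rw [Finset.mem_Icc] at hi ⊢; omega
  · simpa using hij
  · rw [Finset.mem_Icc] at hi
    exact ⟨i - 1, Finset.mem_Icc.2 ⟨by omega, by omega⟩, by omega⟩
  · simp

lemma aHat_succ (X : ℕ → Ω → ℝ) (n : ℕ) (ω : Ω) :
    aHat X (n + 1) ω = (∑ i ∈ Finset.Icc 2 (3 * (n + 1)), X i ω * X (i - 1) ω) /
      ∑ i ∈ Finset.Icc 2 (3 * (n + 1)), X (i - 1) ω ^ 2 := by
  rw [aHat, sum_Icc_one_pred_eq (fun i => X i ω ^ 2)]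

/-- Expanding the square pulls the random coefficient out of the sums, leaving three sums whose
averages have known limits. -/
lemma sigmaSqHat_eq (X : ℕ → Ω → ℝ) (t : ℕ) (ω : Ω) :
    sigmaSqHat X t ω = 1 / (3 * (t : ℝ) - 1) * (∑ i ∈ Finset.Icc 2 (3 * t), X i ω ^ 2 -
      2 * aHat X (t - 1) ω * ∑ i ∈ Finset.Icc 2 (3 * t), X i ω * X (i - 1) ω +
      aHat X (t - 1) ω ^ 2 * ∑ i ∈ Finset.Icc 2 (3 * t), X (i - 1) ω ^ 2) := by
  rw [sigmaSqHat, Finset.mul_sum _ _ (2 * aHat X (t - 1) ω),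
    Finset.mul_sum _ _ (aHat X (t - 1) ω ^ 2), ← Finset.sum_sub_distrib,
    ← Finset.sum_add_distrib]
  congr 1
  exact Finset.sum_congr rfl fun i _ => by ring

lemma tendsto_const_add_div {S : ℕ → ℝ} {l : ℝ} (c : ℝ)
    (h : Tendsto (fun n : ℕ => S n / n) atTop (𝓝 l)) :
    Tendsto (fun n : ℕ => (c + S n) / n) atTop (𝓝 l) := by
  have := (tendsto_const_div_atTop_nhds_zero_nat c).add h
  rw [zero_add] at this
  exact this.congr fun n => (add_div _ _ _).symm

variable [MeasurableSpace Ω] {μ : Measure Ω} {a σ : ℝ} {X ε : ℕ → Ω → ℝ}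
variable [IsProbabilityMeasure μ]

omit [IsProbabilityMeasure μ] in
lemma integral_add_add {f g h : Ω → ℝ} (hf : Integrable f μ) (hg : Integrable g μ)
    (hh : Integrable h μ) :
    ∫ ω, (f ω + g ω + h ω) ∂μ = ∫ ω, f ω ∂μ + ∫ ω, g ω ∂μ + ∫ ω, h ω ∂μ := by
  rw [integral_add (f := fun ω => f ω + g ω) (hf.add hg) hh, integral_add hf hg]

lemma IsStationaryGaussianAR1.tendsto_average_mul (hX : IsStationaryGaussianAR1 a σ X ε μ)
    (hσ : 0 < σ) : ∀ᵐ ω ∂μ, Tendsto (fun n : ℕ =>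
      (∑ i ∈ Finset.Icc 2 (3 * (n + 1)), X i ω * X (i - 1) ω) / n) atTop
      (𝓝 (3 * (a * statDev a σ ^ 2))) := by
  have hint : ∀ t, 1 ≤ t → Integrable (fun ω => X t ω * X (t + 1) ω) μ := fun t ht =>
    (hX.memLp_X hσ ht).integrable_mul (hX.memLp_X hσ (by omega))
  have hI : ∫ ω, crossSum (block X 1 ω) ∂μ = 3 * (a * statDev a σ ^ 2) := by
    have h : ∀ ω, crossSum (block X 1 ω) =
        X 1 ω * X (1 + 1) ω + X 2 ω * X (2 + 1) ω + X 3 ω * X (3 + 1) ω := fun ω => rfl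
    simp only [h]
    rw [integral_add_add (hint 1 (by norm_num)) (hint 2 (by norm_num)) (hint 3 (by norm_num)),
      hX.integral_X_mul hσ (by norm_num), hX.integral_X_mul hσ (by norm_num),
      hX.integral_X_mul hσ (by norm_num)]
    ring
  filter_upwards [hX.tendsto_average_block hσ quadLip_crossSum] with ω hω
  rw [hI] at hω
  simp only [sum_mul_eq_sum_crossSum]
  exact tendsto_const_add_div _ hω

lemma IsStationaryGaussianAR1.integral_sum_three_sq (hX : IsStationaryGaussianAR1 a σ X ε μ)
    (hσ : 0 < σ) (i j k : Fin 4) :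
    ∫ ω, (block X 1 ω i * block X 1 ω i + block X 1 ω j * block X 1 ω j +
      block X 1 ω k * block X 1 ω k) ∂μ = 3 * statDev a σ ^ 2 := by
  have hint : ∀ i : Fin 4, Integrable (fun ω => block X 1 ω i * block X 1 ω i) μ := fun i =>
    (hX.memLp_block hσ le_rfl i).integrable_mul (hX.memLp_block hσ le_rfl i)
  have hI : ∀ i : Fin 4, ∫ ω, block X 1 ω i * block X 1 ω i ∂μ = statDev a σ ^ 2 := fun i => by
    rw [← hX.integral_X_sq hσ (t := 1 + i) (by omega)]
    exact integral_congr_ae (Eventually.of_forall fun ω => (sq (block X 1 ω i)).symm)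
  rw [integral_add_add (hint i) (hint j) (hint k), hI, hI, hI]
  ring

lemma IsStationaryGaussianAR1.tendsto_average_sq (hX : IsStationaryGaussianAR1 a σ X ε μ)
    (hσ : 0 < σ) : ∀ᵐ ω ∂μ, Tendsto (fun n : ℕ =>
      (∑ i ∈ Finset.Icc 2 (3 * (n + 1)), X i ω ^ 2) / n) atTop (𝓝 (3 * statDev a σ ^ 2)) := by
  filter_upwards [hX.tendsto_average_block hσ
    (((quadLip_mul 1 1).add (quadLip_mul 2 2)).add (quadLip_mul 3 3))] with ω hω
  rw [hX.integral_sum_three_sq hσ] at hω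
  simp only [sum_sq_eq_sum_block]
  exact tendsto_const_add_div _ hω

lemma IsStationaryGaussianAR1.tendsto_average_lag_sq (hX : IsStationaryGaussianAR1 a σ X ε μ)
    (hσ : 0 < σ) : ∀ᵐ ω ∂μ, Tendsto (fun n : ℕ =>
      (∑ i ∈ Finset.Icc 2 (3 * (n + 1)), X (i - 1) ω ^ 2) / n) atTop
      (𝓝 (3 * statDev a σ ^ 2)) := by
  filter_upwards [hX.tendsto_average_block hσ
    (((quadLip_mul 0 0).add (quadLip_mul 1 1)).add (quadLip_mul 2 2))] with ω hω
  rw [hX.integral_sum_three_sq hσ] at hω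
  simp only [sum_lag_sq_eq_sum_block]
  exact tendsto_const_add_div _ hω

lemma IsStationaryGaussianAR1.tendsto_aHat (hX : IsStationaryGaussianAR1 a σ X ε μ)
    (hσ : 0 < σ) : ∀ᵐ ω ∂μ, Tendsto (fun t : ℕ => aHat X t ω) atTop (𝓝 a) := by
  have hV := statDev_pos (hX.abs_lt_one hσ) hσ
  filter_upwards [hX.tendsto_average_mul hσ, hX.tendsto_average_lag_sq hσ] with ω h1 h2
  rw [← tendsto_add_atTop_iff_nat 1]
  have := h1.div h2 (by positivity)
  rw [show 3 * (a * statDev a σ ^ 2) / (3 * statDev a σ ^ 2) = a by field_simp] at this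
  refine this.congr' ?_
  filter_upwards [eventually_gt_atTop 0] with n hn
  have hn' : (n : ℝ) ≠ 0 := by positivity
  rw [aHat_succ, Pi.div_apply, div_div_div_cancel_right₀ hn']

lemma IsStationaryGaussianAR1.tendsto_sigmaSqHat (hX : IsStationaryGaussianAR1 a σ X ε μ)
    (hσ : 0 < σ) : ∀ᵐ ω ∂μ, Tendsto (fun t : ℕ => sigmaSqHat X t ω) atTop (𝓝 (σ ^ 2)) := by
  have ha := hX.abs_lt_one hσ
  filter_upwards [hX.tendsto_average_mul hσ, hX.tendsto_average_lag_sq hσ,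
    hX.tendsto_average_sq hσ, hX.tendsto_aHat hσ] with ω h1 h2 h3 h4
  rw [← tendsto_add_atTop_iff_nat 1]
  have h5 : Tendsto (fun n : ℕ => (n : ℝ) / (3 * ((n + 1 : ℕ) : ℝ) - 1)) atTop (𝓝 (1 / 3)) := by
    have := (tendsto_natCast_div_add_atTop (2 / 3 : ℝ)).mul_const (1 / 3)
    rw [one_mul] at this
    refine this.congr fun n => ?_
    have h : (0 : ℝ) < (n : ℝ) + 2 / 3 := by positivity
    have h' : (3 * ((n + 1 : ℕ) : ℝ) - 1) = 3 * ((n : ℝ) + 2 / 3) := by push_cast; ring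
    rw [h']
    field_simp
  have h6 := h5.mul ((h3.sub ((h4.const_mul 2).mul h1)).add ((h4.pow 2).mul h2))
  have hlim : 1 / 3 * (3 * statDev a σ ^ 2 - 2 * a * (3 * (a * statDev a σ ^ 2)) +
      a ^ 2 * (3 * statDev a σ ^ 2)) = σ ^ 2 := by
    have : 0 < 1 - a ^ 2 := by
      have := (sq_lt_one_iff_abs_lt_one a).2 ha
      linarith
    rw [statDev_sq ha]
    field_simp
    ring
  rw [hlim] at h6
  refine h6.congr' ?_
  filter_upwards [eventually_gt_atTop 0] with n hn
  have hn' : (n : ℝ) ≠ 0 := by positivity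
  rw [sigmaSqHat_eq, Nat.add_sub_cancel]
  field_simp

/-- By Fubini: for each fixed value `y` of `Y`, the atomless variable `Z` avoids the single point `F
y`. -/
lemma ae_ne_of_indepFun {Y : Ω → ℝ × ℝ} {Z : Ω → ℝ} (h : IndepFun Y Z μ) (hY : Measurable Y)
    (hZ : Measurable Z) [NullSingletonClass (μ.map Z)] {F : ℝ × ℝ → ℝ} (hF : Measurable F) :
    ∀ᵐ ω ∂μ, Z ω ≠ F (Y ω) := by
  have hprod := (indepFun_iff_map_prod_eq_prod_map_map hY.aemeasurable hZ.aemeasurable).1 h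
  have := Measure.isProbabilityMeasure_map (μ := μ) hZ.aemeasurable
  have := Measure.isProbabilityMeasure_map (μ := μ) hY.aemeasurable
  have hset : MeasurableSet {p : (ℝ × ℝ) × ℝ | p.2 ≠ F p.1} :=
    (measurableSet_eq_fun measurable_snd (hF.comp measurable_fst)).compl
  have h1 : ∀ᵐ p ∂(μ.map (fun ω => (Y ω, Z ω))), p.2 ≠ F p.1 := by
    rw [hprod, Measure.ae_prod_iff_ae_ae hset]
    refine Eventually.of_forall fun y => ?_
    exact measure_mono_null (fun z hz => by simpa using hz) (measure_singleton (F y))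
  exact ae_of_ae_map (hY.prodMk hZ).aemeasurable h1

/-- Serves to exclude a zero variance estimate. When `X 1 ≠ 0`, equality would determine `ε 3` as a
function of the independent pair `(X 1, ε 2)`, namely `X 2 ^ 2 / X 1 - a * X 2`. -/
lemma IsStationaryGaussianAR1.ae_mul_ne_sq (hX : IsStationaryGaussianAR1 a σ X ε μ)
    (hσ : 0 < σ) : ∀ᵐ ω ∂μ, X 3 ω * X 1 ω ≠ X 2 ω ^ 2 := by
  have hv : ∀ v : ℝ, 0 < v → Real.toNNReal (v ^ 2) ≠ 0 := fun v hv =>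
    (Real.toNNReal_pos.2 (by positivity)).ne'
  have hX1 : ∀ᵐ ω ∂μ, X 1 ω ≠ 0 := by
    have : ∀ᵐ x ∂(μ.map (X 1)), x ≠ 0 := by
      rw [hX.map_X_one hσ]
      have := nullSingletonClass_gaussianReal (μ := 0)
        (hv _ (statDev_pos (hX.abs_lt_one hσ) hσ))
      exact measure_mono_null (fun z hz => by simpa using hz)
        (measure_singleton (0 : ℝ))
    exact ae_of_ae_map (hX.measurable_X 1 le_rfl).aemeasurable this
  have hind : IndepFun (fun ω => (X 1 ω, ε 2 ω)) (ε 3) μ :=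
    hX.iIndepFun_inputs.indepFun_prodMk hX.measurable_inputs 0 1 2 (by norm_num) (by norm_num)
  have : NullSingletonClass (μ.map (ε 3)) := by
    rw [hX.innovation_law 3 (by norm_num)]
    exact nullSingletonClass_gaussianReal (hv σ hσ)
  have hF : Measurable fun y : ℝ × ℝ =>
      (a * y.1 + y.2) ^ 2 / y.1 - a * (a * y.1 + y.2) := by fun_prop
  filter_upwards [hX1, hX.recursion 1 (by norm_num), hX.recursion 2 (by norm_num),
    ae_ne_of_indepFun hind ((hX.measurable_X 1 le_rfl).prodMk
      (hX.measurable_innovation 2 le_rfl)) (hX.measurable_innovation 3 (by norm_num)) hF]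
    with ω h1 h2 h3 h4 h
  apply h4
  norm_num at h2 h3
  rw [← h2, ← h, h3]
  field_simp
  ring

/-- If all residuals vanish, then `X 2 = α * X 1` and `X 3 = α * X 2` with the same `α`, hence `X 3
* X 1 = X 2 ^ 2`. Positivity is what lets the plug-in score be written as an exponential of
`logScore`. -/
lemma IsStationaryGaussianAR1.sigmaSqHat_pos (hX : IsStationaryGaussianAR1 a σ X ε μ)
    (hσ : 0 < σ) : ∀ᵐ ω ∂μ, ∀ t : ℕ, 2 ≤ t → 0 < sigmaSqHat X t ω := by
  filter_upwards [hX.ae_mul_ne_sq hσ] with ω hω t ht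
  have ht' : (2 : ℝ) ≤ t := by exact_mod_cast ht
  refine mul_pos (by apply one_div_pos.2; linarith) ?_
  have hnn : ∀ i ∈ Finset.Icc 2 (3 * t), 0 ≤ (X i ω - aHat X (t - 1) ω * X (i - 1) ω) ^ 2 :=
    fun i _ => sq_nonneg _
  refine lt_of_le_of_ne (Finset.sum_nonneg hnn) fun h0 => hω ?_
  have hz := (Finset.sum_eq_zero_iff_of_nonneg hnn).1 h0.symm
  have h2 := pow_eq_zero_iff (two_ne_zero) |>.1 (hz 2 (Finset.mem_Icc.2 ⟨by omega, by omega⟩))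
  have h3 := pow_eq_zero_iff (two_ne_zero) |>.1 (hz 3 (Finset.mem_Icc.2 ⟨by omega, by omega⟩))
  norm_num at h2 h3
  linear_combination (X 1 ω) * h3 - (X 2 ω) * h2

/-! ### Convergence of the log wealth -/

omit [MeasurableSpace Ω] in
lemma score_block_eq (X : ℕ → Ω → ℝ) (α v : ℝ) (hv : 0 < v) (t : ℕ) (ω : Ω) :
    score α v (X (3 * t) ω) (triple X t ω) =
      Real.exp (logScore (α / v) (α ^ 2 / (2 * v)) (block X (3 * t) ω)) := by
  rw [score_eq_exp _ _ _ _ hv]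
  congr 2
  funext i
  fin_cases i <;> rfl

omit [MeasurableSpace Ω] in
lemma log_oracleScore_two (hσ : 0 < σ) (ω : Ω) :
    Real.log (oracleScore a σ X 2 ω) =
      logScore (a / σ ^ 2) (a ^ 2 / (2 * σ ^ 2)) (block X 6 ω) := by
  rw [oracleScore, if_neg (by norm_num), score_block_eq X a _ (by positivity) 2, Real.log_exp]

omit [IsProbabilityMeasure μ] in
lemma IsStationaryGaussianAR1.growthRate_eq (hX : IsStationaryGaussianAR1 a σ X ε μ)
    (hσ : 0 < σ) : growthRate a σ X μ =
      1 / 3 * ∫ ω, logScore (a / σ ^ 2) (a ^ 2 / (2 * σ ^ 2)) (block X 1 ω) ∂μ := by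
  rw [growthRate, ← hX.integral_comp_block (quadLip_logScore _ _).continuous (t := 6)
    (by norm_num)]
  simp only [log_oracleScore_two hσ]

/-- The plug-in log score is compared with the log score at the true parameters on the same block.
Consistency makes the difference a null sequence times the squared block norm, whose averages are
bounded. -/
lemma IsStationaryGaussianAR1.tendsto_log_wealth (hX : IsStationaryGaussianAR1 a σ X ε μ)
    (hσ : 0 < σ) : ∀ᵐ ω ∂μ, Tendsto (fun n : ℕ => Real.log (wealth X n ω) / (3 * (n : ℝ))) atTop
      (𝓝 (growthRate a σ X μ)) := by
  set p := a / σ ^ 2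
  set q := a ^ 2 / (2 * σ ^ 2)
  filter_upwards [hX.tendsto_average_block hσ (quadLip_logScore p q), hX.sum_block_sq_le hσ,
    hX.tendsto_aHat hσ, hX.tendsto_sigmaSqHat hσ, hX.sigmaSqHat_pos hσ] with ω h1 hB ha hs hpos
  obtain ⟨B, hB⟩ := hB
  have hlog : ∀ t, 2 ≤ t → plugInScore X t ω = Real.exp (logScore
      (aHat X t ω / sigmaSqHat X t ω) (aHat X t ω ^ 2 / (2 * sigmaSqHat X t ω))
      (block X (3 * t) ω)) := fun t ht => by
    rw [plugInScore, if_neg (by omega), score_block_eq _ _ _ (hpos t ht)]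
  have hne : ∀ t, plugInScore X t ω ≠ 0 := by
    intro t
    by_cases ht : t ≤ 1
    · rw [plugInScore, if_pos ht]; exact one_ne_zero
    · rw [hlog t (by omega)]; exact Real.exp_ne_zero _
  have hp : Tendsto (fun t : ℕ => aHat X t ω / sigmaSqHat X t ω) atTop (𝓝 p) :=
    ha.div hs (by positivity)
  have hq : Tendsto (fun t : ℕ => aHat X t ω ^ 2 / (2 * sigmaSqHat X t ω)) atTop (𝓝 q) :=
    (ha.pow 2).div (hs.const_mul 2) (by positivity)
  have hδ : Tendsto (fun t : ℕ => 2 * (3 * |aHat X t ω / sigmaSqHat X t ω - p| +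
      2 * |aHat X t ω ^ 2 / (2 * sigmaSqHat X t ω) - q|)) atTop (𝓝 0) := by
    have := ((((hp.sub_const p).abs).const_mul 3).add
      (((hq.sub_const q).abs).const_mul 2)).const_mul 2
    simpa using this
  have hdiff := tendsto_average_zero_of_abs_le_mul
    (d := fun s => Real.log (plugInScore X (s + 1) ω) - logScore p q (block X (3 * (s + 1)) ω))
    (hδ.comp (tendsto_add_atTop_nat 1)) (fun s => Finset.sum_nonneg fun i _ => sq_nonneg _)
    (by
      -- The index `s = 0` is round 1, where no bet is placed and the comparison need not hold.
      filter_upwards [eventually_ge_atTop 1] with s hs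
      rw [hlog (s + 1) (by omega), Real.log_exp]
      refine (abs_logScore_sub_param_le _ _ _ _ _).trans ?_
      exact mul_le_mul_of_nonneg_left (norm_sq_le_sum_sq _) (by positivity)) hB
  have hsum := (h1.add hdiff).const_mul (1 / 3)
  rw [add_zero, ← hX.growthRate_eq hσ] at hsum
  refine hsum.congr fun n => ?_
  have hw : Real.log (wealth X n ω) =
      ∑ s ∈ Finset.range n, Real.log (plugInScore X (s + 1) ω) := by
    rw [wealth, Real.log_prod (fun t _ => hne t), Finset.range_eq_Ico,
      Finset.sum_Ico_add' (fun s => Real.log (plugInScore X s ω)) 0 n 1]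
    rfl
  rw [hw, ← add_div, ← Finset.sum_add_distrib]
  simp only [add_sub_cancel]
  by_cases hn : (n : ℝ) = 0
  · simp [hn]
  · field_simp

end Estimators

/-! ### Transition density of a triple and the mean of the reciprocal score -/

lemma lintegral_pi_succ (ν : Measure ℝ) [SigmaFinite ν] {n : ℕ} {F : (Fin (n + 1) → ℝ) → ENNReal}
    (hF : Measurable F) :
    ∫⁻ x, F x ∂(Measure.pi fun _ : Fin (n + 1) => ν) =
      ∫⁻ x, ∫⁻ y, F (Fin.cons x y) ∂(Measure.pi fun _ : Fin n => ν) ∂ν := by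
  have h := (measurePreserving_piFinSuccAbove (fun _ : Fin (n + 1) => ν) 0).symm
  rw [← h.lintegral_comp hF, lintegral_prod _ (by exact (hF.comp h.measurable).aemeasurable)]
  refine lintegral_congr fun x => lintegral_congr fun y => congrArg F ?_
  exact Fin.insertNth_zero' x y

lemma lintegral_pi_three (ν : Measure ℝ) [SigmaFinite ν] {F : (Fin 3 → ℝ) → ENNReal}
    (hF : Measurable F) :
    ∫⁻ x, F x ∂(Measure.pi fun _ : Fin 3 => ν) =
      ∫⁻ x, ∫⁻ y, ∫⁻ z, F ![x, y, z] ∂ν ∂ν ∂ν := by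
  have hcons : ∀ (n : ℕ) (x : ℝ), Measurable fun y : Fin n → ℝ => (Fin.cons x y : Fin (n + 1) → ℝ) :=
    fun n x => measurable_pi_lambda _ fun i =>
      Fin.cases (by simp) (fun j => by simpa using measurable_pi_apply j) i
  rw [lintegral_pi_succ ν hF]
  refine lintegral_congr fun x => ?_
  rw [lintegral_pi_succ ν (F := fun y => F (Fin.cons x y)) (hF.comp (hcons 2 x))]
  refine lintegral_congr fun y => ?_
  rw [lintegral_pi_succ ν (F := fun z => F (Fin.cons x (Fin.cons y z)))
    ((hF.comp (hcons 2 x)).comp (hcons 1 y))]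
  refine lintegral_congr fun z => ?_
  rw [Measure.pi_of_empty, lintegral_dirac]
  exact congrArg F (by funext i; fin_cases i <;> rfl)

lemma lintegral_gaussianReal_add {v : NNReal} (hv : v ≠ 0) (c : ℝ) {G : ℝ → ENNReal}
    (hG : Measurable G) :
    ∫⁻ e, G (c + e) ∂(gaussianReal 0 v) = ∫⁻ x, gaussianPDF 0 v (x - c) * G x := by
  rw [gaussianReal_of_var_ne_zero 0 hv,
    lintegral_withDensity_eq_lintegral_mul _ (measurable_gaussianPDF 0 v)
      (show Measurable fun e => G (c + e) from hG.comp (measurable_const_add c)),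
    ← lintegral_add_left_eq_self (fun x => gaussianPDF 0 v (x - c) * G x) c]
  refine lintegral_congr fun e => ?_
  simp

/-- The next three values of the recursion, given the present value and the innovations. -/
def arTriple (a w : ℝ) (e : Fin 3 → ℝ) : Fin 3 → ℝ :=
  ![a * w + e 0, a * (a * w + e 0) + e 1, a * (a * (a * w + e 0) + e 1) + e 2]

/-- Transition density of three steps of the recursion. -/
def tripleDensity (a : ℝ) (v : NNReal) (w : ℝ) (x : Fin 3 → ℝ) : ℝ :=
  gaussianPDFReal 0 v (x 0 - a * w) * (gaussianPDFReal 0 v (x 1 - a * x 0) *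
    gaussianPDFReal 0 v (x 2 - a * x 1))

lemma tripleDensity_nonneg (a : ℝ) (v : NNReal) (w : ℝ) (x : Fin 3 → ℝ) :
    0 ≤ tripleDensity a v w x :=
  mul_nonneg (gaussianPDFReal_nonneg _ _ _)
    (mul_nonneg (gaussianPDFReal_nonneg _ _ _) (gaussianPDFReal_nonneg _ _ _))

lemma measurable_tripleDensity (a : ℝ) (v : NNReal) (w : ℝ) :
    Measurable (tripleDensity a v w) := by
  have := measurable_gaussianPDFReal 0 v
  unfold tripleDensity
  fun_prop

lemma continuous_arTriple (a : ℝ) : Continuous fun r : ℝ × (Fin 3 → ℝ) => arTriple a r.1 r.2 := by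
  unfold arTriple
  refine continuous_pi fun i => ?_
  fin_cases i
  · show Continuous fun r : ℝ × (Fin 3 → ℝ) => a * r.1 + r.2 0
    fun_prop
  · show Continuous fun r : ℝ × (Fin 3 → ℝ) => a * (a * r.1 + r.2 0) + r.2 1
    fun_prop
  · show Continuous fun r : ℝ × (Fin 3 → ℝ) => a * (a * (a * r.1 + r.2 0) + r.2 1) + r.2 2
    fun_prop

lemma measurable_vec_three : Measurable fun r : (ℝ × ℝ) × ℝ => (![r.1.1, r.1.2, r.2] : Fin 3 → ℝ) := by
  refine measurable_pi_lambda _ fun i => ?_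
  fin_cases i
  · exact measurable_fst.comp measurable_fst
  · exact measurable_snd.comp measurable_fst
  · exact measurable_snd

/-- The map from innovations to values is triangular with unit diagonal. One translation of Lebesgue
measure per coordinate performs the change of variables. -/
lemma lintegral_arTriple_iterated (a : ℝ) {v : NNReal} (hv : v ≠ 0) (w : ℝ)
    {H : (Fin 3 → ℝ) → ENNReal} (hH : Measurable H) :
    ∫⁻ e₀, ∫⁻ e₁, ∫⁻ e₂, H ![a * w + e₀, a * (a * w + e₀) + e₁,
        a * (a * (a * w + e₀) + e₁) + e₂] ∂(gaussianReal 0 v) ∂(gaussianReal 0 v)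
        ∂(gaussianReal 0 v) =
      ∫⁻ x, gaussianPDF 0 v (x - a * w) * ∫⁻ y, gaussianPDF 0 v (y - a * x) *
        ∫⁻ z, gaussianPDF 0 v (z - a * y) * H ![x, y, z] := by
  have hφ := measurable_gaussianPDF 0 v
  have h3 : Measurable fun r : (ℝ × ℝ) × ℝ => gaussianPDF 0 v (r.2 - a * r.1.2) *
      H ![r.1.1, r.1.2, r.2] := by
    refine (hφ.comp (g := gaussianPDF 0 v) (f := fun r : (ℝ × ℝ) × ℝ => r.2 - a * r.1.2)
      (by fun_prop)).mul (hH.comp measurable_vec_three)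
  have h2' : Measurable fun r : ℝ × ℝ =>
      ∫⁻ z, gaussianPDF 0 v (z - a * r.2) * H ![r.1, r.2, z] :=
    h3.lintegral_prod_right' (ν := volume)
  have h2 : Measurable fun r : ℝ × ℝ => gaussianPDF 0 v (r.2 - a * r.1) *
      ∫⁻ z, gaussianPDF 0 v (z - a * r.2) * H ![r.1, r.2, z] :=
    (hφ.comp (g := gaussianPDF 0 v) (f := fun r : ℝ × ℝ => r.2 - a * r.1)
      (by fun_prop)).mul h2'
  have h1 : Measurable fun x => ∫⁻ y, gaussianPDF 0 v (y - a * x) *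
      ∫⁻ z, gaussianPDF 0 v (z - a * y) * H ![x, y, z] := h2.lintegral_prod_right' (ν := volume)
  have h2s : ∀ x, Measurable fun y => ∫⁻ z, gaussianPDF 0 v (z - a * y) * H ![x, y, z] :=
    fun x => Measurable.of_uncurry_left
      (f := fun x y => ∫⁻ z, gaussianPDF 0 v (z - a * y) * H ![x, y, z]) h2'
  have h3s : ∀ x y, Measurable fun z => H ![x, y, z] := fun x y =>
    hH.comp (measurable_vec_three.comp (measurable_prodMk_left (x := (x, y))))
  refine Eq.trans (lintegral_congr fun e₀ => ?_) (lintegral_gaussianReal_add hv (a * w) h1)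
  refine Eq.trans (lintegral_congr fun e₁ => ?_)
    (lintegral_gaussianReal_add hv (a * (a * w + e₀)) (h2s (a * w + e₀)))
  exact lintegral_gaussianReal_add hv (a * (a * (a * w + e₀) + e₁))
    (h3s (a * w + e₀) (a * (a * w + e₀) + e₁))

lemma lintegral_arTriple (a : ℝ) {v : NNReal} (hv : v ≠ 0) (w : ℝ) {H : (Fin 3 → ℝ) → ENNReal}
    (hH : Measurable H) :
    ∫⁻ e, H (arTriple a w e) ∂(Measure.pi fun _ : Fin 3 => gaussianReal 0 v) =
      ∫⁻ x, ENNReal.ofReal (tripleDensity a v w x) * H x := by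
  have hm : Measurable (arTriple a w) :=
    ((continuous_arTriple a).comp (Continuous.prodMk_right w)).measurable
  have hF : Measurable fun x => ENNReal.ofReal (tripleDensity a v w x) * H x :=
    (measurable_tripleDensity a v w).ennreal_ofReal.mul hH
  have hR : ∫⁻ x, ENNReal.ofReal (tripleDensity a v w x) * H x =
      ∫⁻ x, ∫⁻ y, ∫⁻ z, ENNReal.ofReal (tripleDensity a v w ![x, y, z]) * H ![x, y, z] :=
    lintegral_pi_three volume hF
  rw [lintegral_pi_three _ (F := fun e => H (arTriple a w e)) (hH.comp hm), hR]
  refine (lintegral_arTriple_iterated a hv w hH).trans (lintegral_congr fun x => ?_)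
  rw [← lintegral_const_mul' _ _ gaussianPDF_ne_top]
  refine lintegral_congr fun y => ?_
  rw [← mul_assoc, ← lintegral_const_mul' _ _ (ENNReal.mul_ne_top gaussianPDF_ne_top
    gaussianPDF_ne_top)]
  refine lintegral_congr fun z => ?_
  rw [tripleDensity, ENNReal.ofReal_mul (gaussianPDFReal_nonneg _ _ _),
    ENNReal.ofReal_mul (gaussianPDFReal_nonneg _ _ _)]
  simp only [gaussianPDF, Matrix.cons_val, mul_assoc]

/-- `g` carries the constant of a different power of `2πv`. The correction is the same for all
orderings, so it cancels in ratios. -/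
lemma tripleDensity_eq (a : ℝ) {v : NNReal} (hv : v ≠ 0) (w : ℝ) (x : Fin 3 → ℝ) :
    tripleDensity a v w x =
      (Real.sqrt (2 * Real.pi * v))⁻¹ ^ 3 * (2 * Real.pi * v) * g a v w (x 0) (x 1) (x 2) := by
  have hv' : (v : ℝ) ≠ 0 := by exact_mod_cast hv
  have h : g a v w (x 0) (x 1) (x 2) = 1 / (2 * Real.pi * v) *
      (Real.exp (-(x 0 - a * w - 0) ^ 2 / (2 * v)) * (Real.exp (-(x 1 - a * x 0 - 0) ^ 2 / (2 * v)) *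
        Real.exp (-(x 2 - a * x 1 - 0) ^ 2 / (2 * v)))) := by
    rw [g, ← Real.exp_add, ← Real.exp_add]
    congr 2
    field_simp
    ring
  rw [h, tripleDensity, gaussianPDFReal, gaussianPDFReal, gaussianPDFReal]
  field_simp

/-- The reciprocal score is the mean of `g` over the orderings divided by `g` at the observed one,
and the density cancels this denominator. -/
lemma tripleDensity_mul_exp_neg (a : ℝ) {v : NNReal} (hv : v ≠ 0) (w : ℝ) (x : Fin 3 → ℝ) :
    tripleDensity a v w x *
        Real.exp (-logScore (a / v) (a ^ 2 / (2 * v)) ![w, x 0, x 1, x 2]) =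
      ∑ τ : Equiv.Perm (Fin 3), 1 / 6 * tripleDensity a v w (fun i => x (τ i)) := by
  have hv' : (0 : ℝ) < v := by exact_mod_cast pos_iff_ne_zero.2 hv
  have hg : ∀ x : Fin 3 → ℝ, 0 < g a v w (x 0) (x 1) (x 2) := fun x => by
    rw [g]; positivity
  have hS : 0 < ∑ τ : Equiv.Perm (Fin 3), g a v w (x (τ 0)) (x (τ 1)) (x (τ 2)) :=
    Finset.sum_pos (fun τ _ => hg fun i => x (τ i)) Finset.univ_nonempty
  have h0 := hg x
  rw [Real.exp_neg, ← score_eq_exp a v w x hv', score]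
  simp only [tripleDensity_eq a hv]
  rw [← Finset.mul_sum, ← Finset.mul_sum]
  field_simp

/-- Lebesgue measure is invariant under permuting coordinates, so each of the six reordered
densities has integral `1`. -/
lemma lintegral_exp_neg_logScore (a : ℝ) {v : NNReal} (hv : v ≠ 0) (w : ℝ) :
    ∫⁻ e, ENNReal.ofReal (Real.exp (-logScore (a / v) (a ^ 2 / (2 * v))
      (Fin.cons w (arTriple a w e)))) ∂(Measure.pi fun _ : Fin 3 => gaussianReal 0 v) = 1 := by
  have hd := measurable_tripleDensity a v w
  have hone : ∫⁻ x, ENNReal.ofReal (tripleDensity a v w x) = 1 := by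
    have := lintegral_arTriple a hv w (H := fun _ => 1) measurable_const
    simpa using this.symm
  have hcons : ∀ x : Fin 3 → ℝ, (Fin.cons w x : Fin 4 → ℝ) = ![w, x 0, x 1, x 2] := by
    intro x
    funext i
    fin_cases i <;> rfl
  have hH : Measurable fun x : Fin 3 → ℝ => ENNReal.ofReal (Real.exp
      (-logScore (a / v) (a ^ 2 / (2 * v)) (Fin.cons w x))) := by
    have h1 : Measurable fun x : Fin 3 → ℝ => (Fin.cons w x : Fin 4 → ℝ) :=
      measurable_pi_lambda _ fun i =>
        Fin.cases (by simp) (fun j => by simpa using measurable_pi_apply j) i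
    exact ENNReal.measurable_ofReal.comp (Real.measurable_exp.comp
      ((quadLip_logScore _ _).continuous.measurable.comp h1).neg)
  rw [lintegral_arTriple a hv w hH]
  have hperm : ∀ τ : Equiv.Perm (Fin 3),
      ∫⁻ x : Fin 3 → ℝ, ENNReal.ofReal (1 / 6 * tripleDensity a v w (fun i => x (τ i))) =
        ENNReal.ofReal (1 / 6) := by
    intro τ
    -- `piCongrLeft` reindexes by the inverse, so `τ.symm` yields `x ∘ τ`.
    have hmp := volume_measurePreserving_piCongrLeft (fun _ : Fin 3 => ℝ) τ.symm
    have h1 := hmp.lintegral_comp (f := fun x => ENNReal.ofReal (tripleDensity a v w x))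
      hd.ennreal_ofReal
    simp_rw [ENNReal.ofReal_mul (show (0 : ℝ) ≤ 1 / 6 by norm_num)]
    rw [lintegral_const_mul' _ _ ENNReal.ofReal_ne_top]
    have h2 : ∀ x : Fin 3 → ℝ, MeasurableEquiv.piCongrLeft (fun _ : Fin 3 => ℝ) τ.symm x =
        fun i => x (τ i) := by
      intro x
      funext i
      have := MeasurableEquiv.piCongrLeft_apply_apply τ.symm (β := fun _ => ℝ) x (τ i)
      simpa using this
    simp only [h2] at h1
    rw [h1, hone, mul_one]
  calc _ = ∫⁻ x : Fin 3 → ℝ, ∑ τ : Equiv.Perm (Fin 3),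
        ENNReal.ofReal (1 / 6 * tripleDensity a v w (fun i => x (τ i))) := by
        refine lintegral_congr fun x => ?_
        rw [← ENNReal.ofReal_mul (tripleDensity_nonneg _ _ _ _), hcons,
          tripleDensity_mul_exp_neg a hv, ENNReal.ofReal_sum_of_nonneg]
        exact fun τ _ => mul_nonneg (by norm_num) (tripleDensity_nonneg _ _ _ _)
    _ = ∑ τ : Equiv.Perm (Fin 3), ENNReal.ofReal (1 / 6) := by
        rw [lintegral_finsetSum]
        · exact Finset.sum_congr rfl fun τ _ => hperm τ
        · intro τ _
          refine (Measurable.const_mul (hd.comp ?_) _).ennreal_ofReal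
          exact measurable_pi_lambda _ fun i => measurable_pi_apply _
    _ = 1 := by
        rw [Finset.sum_const, Finset.card_univ, Fintype.card_perm, Fintype.card_fin,
          ← ENNReal.ofReal_nsmul]
        norm_num [Nat.factorial]

/-! ### Sign of the growth rate -/

lemma logScore_zero_param (u : Fin 4 → ℝ) : logScore 0 0 u = 0 := by
  norm_num [logScore, logLik, Fintype.card_perm, Nat.factorial]

/-- All cross products vanish here, so an ordering has `logLik` equal to `0` if the entry `1` comes
last and to `-q` otherwise. The observed ordering is among the best and strictly exceeds the mean.
-/
lemma logScore_pos_of_last (p : ℝ) {q : ℝ} (hq : 0 < q) : 0 < logScore p q ![0, 0, 0, 1] := by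
  have hmul : ∀ i j : Fin 3, i ≠ j → (![0, 0, 1] : Fin 3 → ℝ) i * (![0, 0, 1] : Fin 3 → ℝ) j = 0 := by
    intro i j hij
    fin_cases i <;> fin_cases j <;> simp_all
  have htail : ∀ i : Fin 3, (![0, 0, 0, 1] : Fin 4 → ℝ) i.succ = (![0, 0, 1] : Fin 3 → ℝ) i := by
    intro i; fin_cases i <;> rfl
  have hlik : ∀ τ : Equiv.Perm (Fin 3), logLik p q (permTail τ ![0, 0, 0, 1]) =
      -q * ((![0, 0, 1] : Fin 3 → ℝ) (τ 0) ^ 2 + (![0, 0, 1] : Fin 3 → ℝ) (τ 1) ^ 2) := by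
    intro τ
    have h0 : permTail τ ![0, 0, 0, 1] 0 = 0 := rfl
    have h1 : permTail τ ![0, 0, 0, 1] 1 = (![0, 0, 1] : Fin 3 → ℝ) (τ 0) := htail (τ 0)
    have h2 : permTail τ ![0, 0, 0, 1] 2 = (![0, 0, 1] : Fin 3 → ℝ) (τ 1) := htail (τ 1)
    have h3 : permTail τ ![0, 0, 0, 1] 3 = (![0, 0, 1] : Fin 3 → ℝ) (τ 2) := htail (τ 2)
    rw [logLik, crossSum, h0, h1, h2, h3, hmul _ _ (τ.injective.ne (by decide)),
      hmul _ _ (τ.injective.ne (by decide))]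
    ring
  have hid : logLik p q ![0, 0, 0, 1] = 0 := by simp [logLik, crossSum]
  have hlt : ∑ τ : Equiv.Perm (Fin 3), Real.exp (logLik p q (permTail τ ![0, 0, 0, 1])) <
      ∑ τ : Equiv.Perm (Fin 3), (1 : ℝ) := by
    -- Swapping the first and last positions moves the `1` to the front and gives a term `exp (-q) <
    -- 1`.
    refine Finset.sum_lt_sum (fun τ _ => ?_) ⟨Equiv.swap 0 2, Finset.mem_univ _, ?_⟩
    · rw [hlik, Real.exp_le_one_iff, neg_mul, neg_nonpos]
      positivity
    · rw [hlik, Equiv.swap_apply_left, Real.exp_lt_one_iff, neg_mul, neg_lt_zero]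
      have : (![0, 0, 1] : Fin 3 → ℝ) 2 = 1 := rfl
      rw [this]
      positivity
  have h6 : ∑ τ : Equiv.Perm (Fin 3), (1 : ℝ) = 6 := by
    norm_num [Fintype.card_perm, Nat.factorial]
  rw [h6] at hlt
  have hpos : 0 < ∑ τ : Equiv.Perm (Fin 3), Real.exp (logLik p q (permTail τ ![0, 0, 0, 1])) :=
    Finset.sum_pos (fun τ _ => Real.exp_pos _) Finset.univ_nonempty
  rw [logScore, hid, add_zero, sub_pos]
  exact Real.log_lt_log hpos hlt

lemma isOpenPosMeasure_gaussianReal (m : ℝ) {v : NNReal} (hv : v ≠ 0) :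
    (gaussianReal m v).IsOpenPosMeasure :=
  (gaussianReal_absolutelyContinuous' m hv).isOpenPosMeasure

section Growth

variable {Ω : Type*} [MeasurableSpace Ω] {μ : Measure Ω} {a σ : ℝ} {X ε : ℕ → Ω → ℝ}
variable [IsProbabilityMeasure μ]

lemma toNNReal_sq_ne_zero {s : ℝ} (hs : 0 < s) : Real.toNNReal (s ^ 2) ≠ 0 :=
  (Real.toNNReal_pos.2 (by positivity)).ne'

lemma IsStationaryGaussianAR1.map_X_one_window (hX : IsStationaryGaussianAR1 a σ X ε μ)
    (hσ : 0 < σ) : μ.map (fun ω => (X 1 ω, window X ε 3 1 ω)) =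
      (gaussianReal 0 (Real.toNNReal (statDev a σ ^ 2))).prod
        (Measure.pi fun _ : Fin 3 => gaussianReal 0 (Real.toNNReal (σ ^ 2))) := by
  have hind : IndepFun (X 1) (window X ε 3 1) μ :=
    -- Input `0` is `X 1` itself, so it is the one-entry window at `0`, disjoint from the window `ε
    -- 2, ε 3, ε 4` at `1`.
    (hX.indepFun_window (K := 1) (K' := 3) (n := 0) (m := 1) le_rfl).comp
      (measurable_pi_apply (0 : Fin 1)) measurable_id
  rw [(indepFun_iff_map_prod_eq_prod_map_map (hX.measurable_X 1 le_rfl).aemeasurable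
    (hX.measurable_window 3 1).aemeasurable).1 hind, hX.map_X_one hσ, hX.map_window 3 le_rfl]

omit [IsProbabilityMeasure μ] in
lemma IsStationaryGaussianAR1.block_one_eq (hX : IsStationaryGaussianAR1 a σ X ε μ) :
    ∀ᵐ ω ∂μ, block X 1 ω = Fin.cons (X 1 ω) (arTriple a (X 1 ω) (window X ε 3 1 ω)) := by
  filter_upwards [hX.eq_arPath] with ω hω
  funext i
  rw [block, hω 1 i le_rfl]
  fin_cases i <;> rfl

lemma continuous_cons_arTriple (a : ℝ) : Continuous fun r : ℝ × (Fin 3 → ℝ) =>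
    (Fin.cons r.1 (arTriple a r.1 r.2) : Fin 4 → ℝ) := by
  refine continuous_pi fun i => ?_
  refine Fin.cases ?_ (fun j => ?_) i
  · exact continuous_fst
  · exact (continuous_apply j).comp (continuous_arTriple a)

lemma IsStationaryGaussianAR1.lintegral_exp_neg_logScore_block
    (hX : IsStationaryGaussianAR1 a σ X ε μ) (hσ : 0 < σ) :
    ∫⁻ ω, ENNReal.ofReal (Real.exp (-logScore (a / σ ^ 2) (a ^ 2 / (2 * σ ^ 2))
      (block X 1 ω))) ∂μ = 1 := by
  set p := a / σ ^ 2
  set q := a ^ 2 / (2 * σ ^ 2)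
  set G : ℝ × (Fin 3 → ℝ) → ENNReal := fun r =>
    ENNReal.ofReal (Real.exp (-logScore p q (Fin.cons r.1 (arTriple a r.1 r.2)))) with hG
  have hGm : Measurable G := by
    have := (quadLip_logScore p q).continuous.comp (continuous_cons_arTriple a)
    exact (Real.continuous_exp.comp this.neg).measurable.ennreal_ofReal
  have hm := (hX.measurable_X 1 le_rfl).prodMk (hX.measurable_window 3 1)
  calc _ = ∫⁻ ω, G (X 1 ω, window X ε 3 1 ω) ∂μ := by
        refine lintegral_congr_ae ?_
        filter_upwards [hX.block_one_eq] with ω hω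
        rw [hω]
    _ = ∫⁻ r, G r ∂(μ.map (fun ω => (X 1 ω, window X ε 3 1 ω))) := (lintegral_map hGm hm).symm
    _ = 1 := by
        rw [hX.map_X_one_window hσ, lintegral_prod _ hGm.aemeasurable]
        have h : ∀ w, ∫⁻ e, G (w, e)
            ∂(Measure.pi fun _ : Fin 3 => gaussianReal 0 (Real.toNNReal (σ ^ 2))) = 1 := fun w => by
          have := lintegral_exp_neg_logScore a (toNNReal_sq_ne_zero hσ) w
          rw [Real.coe_toNNReal _ (sq_nonneg σ)] at this
          exact this
        simp [h]

lemma IsStationaryGaussianAR1.integrable_logScore_block (hX : IsStationaryGaussianAR1 a σ X ε μ)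
    (hσ : 0 < σ) (p q : ℝ) {t : ℕ} (ht : 1 ≤ t) :
    Integrable (fun ω => logScore p q (block X t ω)) μ :=
  integrable_comp_of_quadLip (quadLip_logScore p q) fun i => hX.memLp_block hσ ht i

/-- The deficiency of `log` from its tangent at `1` has the same integral as the log score, because
the reciprocal of the score has expectation one. -/
lemma IsStationaryGaussianAR1.integral_logScore_eq (hX : IsStationaryGaussianAR1 a σ X ε μ)
    (hσ : 0 < σ) {L : Ω → ℝ}
    (hL : L = fun ω => logScore (a / σ ^ 2) (a ^ 2 / (2 * σ ^ 2)) (block X 1 ω)) :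
    Integrable (fun ω => L ω + (Real.exp (-L ω) - 1)) μ ∧
      ∫ ω, (L ω + (Real.exp (-L ω) - 1)) ∂μ = ∫ ω, L ω ∂μ := by
  have hLi : Integrable L μ := hL ▸ hX.integrable_logScore_block hσ _ _ le_rfl
  have hlint : ∫⁻ ω, ENNReal.ofReal (Real.exp (-L ω)) ∂μ = 1 := by
    rw [hL]; exact hX.lintegral_exp_neg_logScore_block hσ
  have hm : AEStronglyMeasurable (fun ω => Real.exp (-L ω)) μ :=
    Real.continuous_exp.comp_aestronglyMeasurable hLi.1.neg
  have hnn : 0 ≤ᵐ[μ] fun ω => Real.exp (-L ω) :=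
    Eventually.of_forall fun ω => (Real.exp_pos _).le
  have hUi : Integrable (fun ω => Real.exp (-L ω)) μ := by
    refine ⟨hm, ?_⟩
    rw [hasFiniteIntegral_iff_ofReal hnn, hlint]
    exact ENNReal.one_lt_top
  have hU : ∫ ω, Real.exp (-L ω) ∂μ = 1 := by
    rw [integral_eq_lintegral_of_nonneg_ae hnn hm, hlint, ENNReal.toReal_one]
  have hU1 : Integrable (fun ω => Real.exp (-L ω) - 1) μ := hUi.sub (integrable_const 1)
  refine ⟨hLi.add hU1, ?_⟩
  rw [integral_add hLi hU1, integral_sub hUi (integrable_const 1), hU]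
  simp

lemma IsStationaryGaussianAR1.growthRate_nonneg (hX : IsStationaryGaussianAR1 a σ X ε μ)
    (hσ : 0 < σ) : 0 ≤ growthRate a σ X μ := by
  rw [hX.growthRate_eq hσ, ← (hX.integral_logScore_eq hσ rfl).2]
  refine mul_nonneg (by norm_num) (integral_nonneg fun ω => ?_)
  show (0 : ℝ) ≤ _
  have := Real.add_one_le_exp
    (-logScore (a / σ ^ 2) (a ^ 2 / (2 * σ ^ 2)) (block X 1 ω))
  linarith

/-- A zero rate forces the log score to vanish almost surely, since `exp (-L) > 1 - L` unless `L =
0`. But the log score is continuous in `(X 1, ε 2, ε 3, ε 4)`, whose law charges every nonempty open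
set, and for `a ≠ 0` it is nonzero at some point. -/
lemma IsStationaryGaussianAR1.growthRate_eq_zero_iff (hX : IsStationaryGaussianAR1 a σ X ε μ)
    (hσ : 0 < σ) : growthRate a σ X μ = 0 ↔ a = 0 := by
  constructor
  · intro h
    by_contra ha
    rw [hX.growthRate_eq hσ] at h
    set p := a / σ ^ 2
    set q := a ^ 2 / (2 * σ ^ 2)
    obtain ⟨hi, heq⟩ := hX.integral_logScore_eq hσ rfl
    have h0 : ∫ ω, logScore p q (block X 1 ω) ∂μ = 0 := by linarith
    rw [h0, integral_eq_zero_iff_of_nonneg (fun ω => by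
      show (0 : ℝ) ≤ _
      have := Real.add_one_le_exp (-logScore p q (block X 1 ω))
      linarith) hi] at heq
    have hae : ∀ᵐ ω ∂μ, logScore p q
        (Fin.cons (X 1 ω) (arTriple a (X 1 ω) (window X ε 3 1 ω))) = 0 := by
      filter_upwards [heq, hX.block_one_eq] with ω h1 h2
      rw [← h2]
      by_contra hne
      have := Real.add_one_lt_exp (neg_ne_zero.2 hne)
      simp only [Pi.zero_apply] at h1
      linarith
    set O : Set (ℝ × (Fin 3 → ℝ)) :=
      {r | logScore p q (Fin.cons r.1 (arTriple a r.1 r.2)) ≠ 0} with hO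
    have hopen : IsOpen O := isOpen_ne_fun
      ((quadLip_logScore p q).continuous.comp (continuous_cons_arTriple a)) continuous_const
    -- Starting from `0` with innovations `0, 0, 1`, the recursion produces the block `(0, 0, 0,
    -- 1)`.
    have hmem : ((0 : ℝ), (![0, 0, 1] : Fin 3 → ℝ)) ∈ O := by
      have hvec : (Fin.cons (0 : ℝ) (arTriple a 0 ![0, 0, 1]) : Fin 4 → ℝ) = ![0, 0, 0, 1] := by
        funext i
        fin_cases i <;> simp [arTriple]
      rw [hO, Set.mem_ofPred_eq, hvec]
      exact (logScore_pos_of_last p (by positivity)).ne'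
    have := isOpenPosMeasure_gaussianReal 0
      (toNNReal_sq_ne_zero (statDev_pos (hX.abs_lt_one hσ) hσ))
    have := isOpenPosMeasure_gaussianReal 0 (toNNReal_sq_ne_zero hσ)
    have hm := (hX.measurable_X 1 le_rfl).prodMk (hX.measurable_window 3 1)
    have hpos := hopen.measure_pos
      ((gaussianReal 0 (Real.toNNReal (statDev a σ ^ 2))).prod
        (Measure.pi fun _ : Fin 3 => gaussianReal 0 (Real.toNNReal (σ ^ 2)))) ⟨_, hmem⟩
    rw [← hX.map_X_one_window hσ, Measure.map_apply hm hopen.measurableSet] at hpos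
    exact hpos.ne' (ae_iff.1 hae)
  · rintro rfl
    rw [hX.growthRate_eq hσ]
    simp [logScore_zero_param]

/-! ### Exchangeability when the coefficient vanishes -/

/-- For `a = 0` the process coincides almost surely with the independent inputs, and the stationary
variance is `σ ^ 2`, so `X 1` has the law of the innovations. Any choice of distinct indices then
gives the same product law. -/
lemma IsStationaryGaussianAR1.isExchangeable (hX : IsStationaryGaussianAR1 0 σ X ε μ)
    (hσ : 0 < σ) : IsExchangeable X μ := by
  have hlaw : ∀ n, μ.map (inputs X ε n) = gaussianReal 0 (Real.toNNReal (σ ^ 2)) := by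
    intro n
    cases n with
    | zero =>
      have := hX.map_X_one hσ
      rw [statDev_sq (by simp)] at this
      simp only [ne_eq, OfNat.ofNat_ne_zero, not_false_eq_true, zero_pow, sub_zero, div_one] at this
      exact this
    | succ n => exact hX.map_inputs (by omega)
  have hXin : ∀ᵐ ω ∂μ, ∀ n, X (n + 1) ω = inputs X ε n ω := by
    rw [ae_all_iff]
    intro n
    cases n with
    | zero => exact Eventually.of_forall fun ω => rfl
    | succ n =>
      filter_upwards [hX.recursion (n + 1) (by omega)] with ω hω
      rw [hω, zero_mul, zero_add]
      rfl
  have hmap : ∀ (n : ℕ) (φ : Fin n → ℕ), Function.Injective φ →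
      μ.map (fun ω (i : Fin n) => X (φ i + 1) ω) =
        Measure.pi (fun _ : Fin n => gaussianReal 0 (Real.toNNReal (σ ^ 2))) := by
    intro n φ hφ
    have h1 : μ.map (fun ω (i : Fin n) => X (φ i + 1) ω) =
        μ.map (fun ω (i : Fin n) => inputs X ε (φ i) ω) := by
      refine Measure.map_congr ?_
      filter_upwards [hXin] with ω hω
      funext i
      exact hω (φ i)
    have h2 := (hX.iIndepFun_inputs.precomp hφ).map_fun_eq_pi_map
      (fun i => (hX.measurable_inputs _).aemeasurable)
    rw [h1]
    refine h2.trans ?_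
    congr 1
    funext i
    exact hlaw (φ i)
  intro n τ
  rw [hmap n (fun i => (τ i : ℕ)) (Fin.val_injective.comp τ.injective),
    hmap n (fun i => (i : ℕ)) Fin.val_injective]

end Growth

end TripleBetting

end

theorem theoremB2 {Ω : Type*} [MeasurableSpace Ω] (μ : Measure Ω) [IsProbabilityMeasure μ]
    (a σ : ℝ) (hσ : 0 < σ) (X ε : ℕ → Ω → ℝ)
    (hX : TripleBetting.IsStationaryGaussianAR1 a σ X ε μ) :
    Integrable (fun ω => Real.log (TripleBetting.oracleScore a σ X 2 ω)) μ ∧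
    (∀ᵐ ω ∂μ, Tendsto (fun n : ℕ => Real.log (TripleBetting.wealth X n ω) / (3 * (n : ℝ))) atTop
      (𝓝 (TripleBetting.growthRate a σ X μ))) ∧
    0 ≤ TripleBetting.growthRate a σ X μ ∧
    (TripleBetting.growthRate a σ X μ = 0 ↔ a = 0) ∧
    (a = 0 → TripleBetting.IsExchangeable X μ) := by
  refine ⟨?_, hX.tendsto_log_wealth hσ, hX.growthRate_nonneg hσ, hX.growthRate_eq_zero_iff hσ, ?_⟩
  · simp only [TripleBetting.log_oracleScore_two hσ]
    exact hX.integrable_logScore_block hσ _ _ (by norm_num)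
  · rintro rfl
    exact hX.isExchangeable hσ
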